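/- Let $\mathbb D$ be the open unit disc and $dA$ the area measure on $\mathbb D$ normalized to total mass $1$. A radial weight is a positive, measurable and integrable function $\omega$ on $[0,1)$, extended to $\mathbb D$ by $\omega(z)=\omega(|z|)$; it is called regular, $\omega\in\mathcal R$, if there are constants $0<c\le C<\infty$ such that $$c\le \frac{\int_r^1\omega(t)\,dt}{(1-r)\,\omega(r)}\le C\qquad\text{for all } r\in[0,1).$$ For $0<p<\infty$ the weighted Bergman space $A^p_\omega$ consists of all analytic functions $f$ on $\mathbb D$ with $\|f\|_{A^p_\omega}^p=\int_{\mathbb D}|f|^p\,\omega\,dA<\infty$. For $0<s<\infty$, a positive Borel measure $\mu$ on $\mathbb D$ is a vanishing $s$-Carleson measure for $A^p_\omega$ if the identity operator $I_d:A^p_\omega\to L^s_\mu$ is (well defined and) compact, i.e. $A^p_\omega\subset L^s_\mu$ and every bounded sequence in $A^p_\omega$ has a subsequence that converges in $L^s_\mu$. **Theorem 3.** Let $n\ge 1$, $0<p_i,q_i<\infty$ and $\omega_i\in\mathcal R$ for $i=1,\dots,n$, and let $\mu$ be a positive Borel measure on $\mathbb D$. Put $$\lambda=\sum_{i=1}^n\frac{q_i}{p_i},\qquad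 \omega(z)=\prod_{i=1}^n\omega_i(z)^{\frac{q_i}{\lambda p_i}}.$$ Then the following statements are equivalent. (i) $\mu$ is a vanishing $\lambda$-Carleson measure for $A^1_\omega$. (ii) For every sequence $\{f_{1,k}\}_{k=1}^\infty$ that is bounded in $A^{p_1}_{\omega_1}$ and converges to $0$ uniformly on compact subsets of $\mathbb D$, $\lim_{k\to\infty}F(k)=0$, where $$F(k)=\sup\Big\{\int_{\mathbb D}|f_{1,k}(z)|^{q_1}\prod_{i=2}^n|f_i(z)|^{q_i}\,d\mu(z)\;:\;f_i\in A^{p_i}_{\omega_i},\ \|f_i\|_{A^{p_i}_{\omega_i}}\le 1,\ i=2,\dots,n\Big\}\in[0,\infty].$$ (iii) For all sequences $\{f_{1,k}\}_{k=1}^\infty,\dots,\{f_{n,k}\}_{k=1}^\infty$ that are bounded in $A^{p_1}_{\omega_1},\dots,A^{p_n}_{\omega_n}$, respectively, and all converge to $0$ uniformly on compact subsets of $\mathbb D$, $$\lim_{k\to\infty}\int_{\mathbb D}\prod_{i=1}^n|f_{i,k}(z)|^{q_i}\,d\mu(z)=0.$$ -/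

import Mathlib

open MeasureTheory Filter Topology
open scoped ENNReal NNReal

noncomputable section

namespace WeightedBergman

/-- The open unit disc of the complex plane. -/
abbrev disc : Set ℂ := Metric.ball (0 : ℂ) 1

/-- The tail integral `∫_r^1 w(t) dt` of a function on `[0, 1)`. -/
def tail (w : ℝ → ℝ) (r : ℝ) : ℝ := ∫ t in r..1, w t

/-- A radial weight, given by its radial profile: only the values on `[0, 1)` matter.
`IntegrableOn` contains the (Lebesgue) measurability. -/
structure IsRadialWeight (w : ℝ → ℝ) : Prop where
  pos : ∀ r ∈ Set.Ico (0 : ℝ) 1, 0 < w r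
  integrableOn : IntegrableOn w (Set.Ico (0 : ℝ) 1)

/-- A regular weight: a radial weight whose tail at `r` is comparable to `(1 - r) w(r)`,
uniformly in `r ∈ [0, 1)`. -/
structure IsRegularWeight (w : ℝ → ℝ) : Prop extends IsRadialWeight w where
  comparable : ∃ c C : ℝ, 0 < c ∧ ∀ r ∈ Set.Ico (0 : ℝ) 1,
    c ≤ tail w r / ((1 - r) * w r) ∧ tail w r / ((1 - r) * w r) ≤ C

/-- The area measure on the unit disc, normalized to total mass one. -/
def discArea : Measure ℂ := ENNReal.ofReal (Real.pi⁻¹) • (volume.restrict disc)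

/-- The measure `w(|z|) dA(z)` on the unit disc. -/
def weightedArea (w : ℝ → ℝ) : Measure ℂ :=
  discArea.withDensity fun z => ENNReal.ofReal (w ‖z‖)

/-- The (quasi-)norm `(∫ |f|^p w dA)^(1/p)`, with values in `[0, ∞]`. -/
def bergmanNorm (p : ℝ) (w : ℝ → ℝ) (f : ℂ → ℂ) : ℝ≥0∞ :=
  eLpNorm f (ENNReal.ofReal p) (weightedArea w)

/-- The weighted Bergman space of the functions that are analytic in the disc and have finite
norm. The values outside the disc are irrelevant. -/
def bergmanSpace (p : ℝ) (w : ℝ → ℝ) : Set (ℂ → ℂ) :=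
  {f | DifferentiableOn ℂ f disc ∧ bergmanNorm p w f < ∞}

/-- A sequence that lies in the weighted Bergman space and is bounded there. -/
def BoundedSeq (p : ℝ) (w : ℝ → ℝ) (f : ℕ → ℂ → ℂ) : Prop :=
  (∀ k, f k ∈ bergmanSpace p w) ∧ ∃ C : ℝ≥0, ∀ k, bergmanNorm p w (f k) ≤ C

/-- Convergence to zero, uniformly on the compact subsets of the disc. -/
def TendstoZeroOnCompacts (f : ℕ → ℂ → ℂ) : Prop :=
  ∀ K ⊆ disc, IsCompact K → TendstoUniformlyOn f (fun _ => (0 : ℂ)) atTop K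

/-- `μ` is a vanishing `q`-Carleson measure for the weighted Bergman space with exponent `p`
and weight `w`: the identity maps this space into `L^q(μ)`, as a compact operator, i.e.
every bounded sequence has a subsequence that converges in `L^q(μ)`. (For `q < 1`, too, `L^q(μ)` is
metrizable, so sequences suffice. Only the restriction of `μ` to the disc matters.) -/
def IsVanishingCarleson (q p : ℝ) (w : ℝ → ℝ) (μ : Measure ℂ) : Prop :=
  (∀ f ∈ bergmanSpace p w, MemLp f (ENNReal.ofReal q) (μ.restrict disc)) ∧
  ∀ f : ℕ → ℂ → ℂ, BoundedSeq p w f →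
    ∃ g : ℂ → ℂ, MemLp g (ENNReal.ofReal q) (μ.restrict disc) ∧
      ∃ φ : ℕ → ℕ, StrictMono φ ∧
        Tendsto (fun k => eLpNorm (f (φ k) - g) (ENNReal.ofReal q) (μ.restrict disc))
          atTop (𝓝 0)

end WeightedBergman

end

/-!
A regular weight lies between two powers of `1 - r`, so it is almost constant on the cells of a
Whitney lattice, and by subharmonicity of `|f| ^ p` the norm of `f` controls its size on every
cell. All three statements are equivalent to one condition on the densities
`μ(cell) / |cell|_ω ^ λ`: those near the circle are small in the norm of the dual of `ℓ^(1/λ)`.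
This condition depends on the exponents and weights only through `λ` and `ω`, because
`|cell|_ω ^ λ = ∏ |cell|_ωᵢ ^ (qᵢ / pᵢ)`; statement (i) is the case of a single factor.

Sufficiency: near the circle the integral is at most a sum over cells, and the sequences tend to
zero uniformly on the remaining compact set. Necessity: the test functions `∑ c_a K_a ^ M`, with
`K_a` a normalized Szegő kernel, have norm at most a constant if `∑ |c_a| ^ pᵢ |cell|_ωᵢ ≤ 1`, and
the coefficients can be chosen such that `|c_a| ^ pᵢ |cell|_ωᵢ = x_a` for all `i`. Taking the sums
over subsets of the lattice points and averaging over all subsets prevents cancellation, so the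
integral of the product dominates the sum of the contributions of the individual cells.
-/

noncomputable section

namespace WeightedBergman

/-- A weight on `[0, 1)` that lies between two powers of `1 - r` uniformly at all scales: up to
constants `w s / w r` is at most `((1 - s) / (1 - r)) ^ (α - 1)` and at least
`((1 - s) / (1 - r)) ^ (β - 1)` for `r ≤ s`. This is the form in which regularity enters the
estimates for Bergman spaces; the shift by one makes `α > 0` the condition for integrability. -/
structure IsPowerWeight (α β : ℝ) (w : ℝ → ℝ) : Prop where
  exponent_pos : 0 < α
  pos : ∀ r ∈ Set.Ico (0 : ℝ) 1, 0 < w r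
  aemeasurable : AEMeasurable w (volume.restrict (Set.Ico 0 1))
  exists_bounds : ∃ K > 0, ∀ r s : ℝ, 0 ≤ r → r ≤ s → s < 1 →
    w s ≤ K * (w r * ((1 - s) / (1 - r)) ^ (α - 1)) ∧
      w r * ((1 - s) / (1 - r)) ^ (β - 1) ≤ K * w s

section RegularWeight

lemma antitoneOn_mul_one_sub_rpow_neg {G G' : ℝ → ℝ} {κ : ℝ} (hG : ContinuousOn G (Set.Ico 0 1))
    (hG' : ∀ r ∈ Set.Ioo (0 : ℝ) 1, HasDerivAt G (G' r) r)
    (hle : ∀ r ∈ Set.Ioo (0 : ℝ) 1, (1 - r) * G' r ≤ -κ * G r) :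
    AntitoneOn (fun r => G r * (1 - r) ^ (-κ)) (Set.Ico 0 1) := by
  have hpos : ∀ r ∈ Set.Ico (0 : ℝ) 1, 0 < 1 - r := fun r hr => sub_pos.2 hr.2
  refine antitoneOn_of_hasDerivWithinAt_nonpos
    (f' := fun r => G' r * (1 - r) ^ (-κ) + G r * (κ * (1 - r) ^ (-κ - 1))) (convex_Ico 0 1)
    (hG.mul (ContinuousOn.rpow_const (by fun_prop) fun r hr => Or.inl (hpos r hr).ne'))
    (fun r hr => ?_) fun r hr => ?_ <;> rw [interior_Ico] at hr
  · have hr0 := hpos r (Set.Ioo_subset_Ico_self hr)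
    have h := ((hasDerivAt_id r).const_sub 1).rpow_const (p := -κ) (Or.inl hr0.ne')
    exact (((hG' r hr).mul h).congr_deriv (by simp)).hasDerivWithinAt
  · have hr0 := hpos r (Set.Ioo_subset_Ico_self hr)
    calc G' r * (1 - r) ^ (-κ) + G r * (κ * (1 - r) ^ (-κ - 1))
        = ((1 - r) * G' r - -κ * G r) * (1 - r) ^ (-κ - 1) := by
          rw [Real.rpow_sub_one hr0.ne']; field_simp; ring
      _ ≤ 0 := mul_nonpos_of_nonpos_of_nonneg (sub_nonpos.2 (hle r hr)) (by positivity)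

variable {w : ℝ → ℝ}

lemma IsRadialWeight.intervalIntegrable (hw : IsRadialWeight w) {r s : ℝ} (hr : r ∈ Set.Icc 0 1)
    (hs : s ∈ Set.Icc 0 1) : IntervalIntegrable w volume r s :=
  (IntervalIntegrable.mono_set (a := 0) (b := 1)
    ((intervalIntegrable_iff_integrableOn_Ico_of_le zero_le_one).2 hw.integrableOn) <| by
      rw [Set.uIcc_of_le zero_le_one]; exact Set.uIcc_subset_Icc hr hs)

lemma IsRadialWeight.continuousOn_tail (hw : IsRadialWeight w) :
    ContinuousOn (tail w) (Set.Icc 0 1) := by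
  have h : IntegrableOn w (Set.uIcc 0 1) := by
    rw [Set.uIcc_of_le zero_le_one, integrableOn_Icc_iff_integrableOn_Ico]
    exact hw.integrableOn
  rw [← Set.uIcc_of_le zero_le_one]
  exact intervalIntegral.continuousOn_primitive_interval_left h

lemma IsRadialWeight.tail_mono {v : ℝ → ℝ} (hv : IsRadialWeight v) (hw : IsRadialWeight w) {c : ℝ}
    (h : ∀ r ∈ Set.Ico (0 : ℝ) 1, v r ≤ c * w r) {r : ℝ} (hr : r ∈ Set.Ico (0 : ℝ) 1) :
    tail v r ≤ c * tail w r := by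
  have hr' := Set.Ico_subset_Icc_self hr
  rw [tail, tail, ← intervalIntegral.integral_const_mul]
  exact intervalIntegral.integral_mono_on_of_le_Ioo hr.2.le
    (hv.intervalIntegrable hr' (by simp)) ((hw.intervalIntegrable hr' (by simp)).const_mul c)
    fun t ht => h t ⟨hr.1.trans ht.1.le, ht.2⟩

lemma IsRegularWeight.exists_tail_bounds (hw : IsRegularWeight w) :
    ∃ c C : ℝ, 0 < c ∧ 0 < C ∧ ∀ r ∈ Set.Ico (0 : ℝ) 1,
      c * w r ≤ tail w r / (1 - r) ∧ tail w r / (1 - r) ≤ C * w r := by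
  obtain ⟨c, C, hc, h⟩ := hw.comparable
  have h0 := h 0 (by simp)
  refine ⟨c, C, hc, hc.trans_le (h0.1.trans h0.2), fun r hr => ?_⟩
  obtain ⟨h₁, h₂⟩ := h r hr
  rw [← div_div] at h₁ h₂
  exact ⟨(le_div_iff₀ (hw.pos r hr)).1 h₁, (div_le_iff₀ (hw.pos r hr)).1 h₂⟩

lemma IsRegularWeight.isRadialWeight_tail_div (hw : IsRegularWeight w) :
    IsRadialWeight fun r => tail w r / (1 - r) := by
  obtain ⟨c, C, hc, -, h⟩ := hw.exists_tail_bounds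
  have hpos : ∀ r ∈ Set.Ico (0 : ℝ) 1, 0 < tail w r / (1 - r) := fun r hr =>
    (mul_pos hc (hw.pos r hr)).trans_le (h r hr).1
  have hcont : ContinuousOn (fun r => tail w r / (1 - r)) (Set.Ico 0 1) :=
    (hw.continuousOn_tail.mono Set.Ico_subset_Icc_self).div (by fun_prop)
      fun r hr => (sub_pos.2 hr.2).ne'
  refine ⟨hpos, (hw.integrableOn.const_mul C).mono
    (hcont.aestronglyMeasurable measurableSet_Ico) ?_⟩
  filter_upwards [ae_restrict_mem measurableSet_Ico] with r hr
  rw [Real.norm_of_nonneg (hpos r hr).le]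
  exact (h r hr).2.trans (le_abs_self _)

/-- The tail of `tail w r / (1 - r)`. For a regular weight it is comparable to `tail w`, and unlike
`tail w` it is differentiable everywhere, so that its growth can be read off from its derivative. -/
def smoothTail (w : ℝ → ℝ) : ℝ → ℝ := tail fun r => tail w r / (1 - r)

lemma IsRegularWeight.hasDerivAt_smoothTail (hw : IsRegularWeight w) {r : ℝ}
    (hr : r ∈ Set.Ioo (0 : ℝ) 1) : HasDerivAt (smoothTail w) (-(tail w r / (1 - r))) r := by
  have hcont : ContinuousOn (fun t => tail w t / (1 - t)) (Set.Ioo 0 1) :=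
    (hw.continuousOn_tail.mono Set.Ioo_subset_Icc_self).div (by fun_prop)
      fun t ht => (sub_pos.2 ht.2).ne'
  exact intervalIntegral.integral_hasDerivAt_left
    (hw.isRadialWeight_tail_div.intervalIntegrable (Set.Ioo_subset_Icc_self hr) (by simp))
    (hcont.stronglyMeasurableAtFilter isOpen_Ioo r hr) (hcont.continuousAt (isOpen_Ioo.mem_nhds hr))

lemma IsRegularWeight.exists_smoothTail_bounds (hw : IsRegularWeight w) :
    ∃ c C : ℝ, 0 < c ∧ 0 < C ∧ ∀ r ∈ Set.Ico (0 : ℝ) 1,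
      (c * w r ≤ tail w r / (1 - r) ∧ tail w r / (1 - r) ≤ C * w r) ∧
        c * tail w r ≤ smoothTail w r ∧ smoothTail w r ≤ C * tail w r := by
  obtain ⟨c, C, hc, hC, h⟩ := hw.exists_tail_bounds
  refine ⟨c, C, hc, hC, fun r hr => ⟨h r hr, ?_,
    hw.isRadialWeight_tail_div.tail_mono hw.toIsRadialWeight (fun t ht => (h t ht).2) hr⟩⟩
  have hle : ∀ t ∈ Set.Ico (0 : ℝ) 1, w t ≤ c⁻¹ * (tail w t / (1 - t)) := fun t ht => by
    rw [← div_eq_inv_mul, le_div_iff₀' hc]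
    exact (h t ht).1
  calc c * tail w r ≤ c * (c⁻¹ * smoothTail w r) := by
        gcongr
        exact hw.toIsRadialWeight.tail_mono hw.isRadialWeight_tail_div hle hr
    _ = smoothTail w r := mul_inv_cancel_left₀ hc.ne' _

lemma IsRegularWeight.continuousOn_smoothTail (hw : IsRegularWeight w) :
    ContinuousOn (smoothTail w) (Set.Ico 0 1) :=
  hw.isRadialWeight_tail_div.continuousOn_tail.mono Set.Ico_subset_Icc_self

lemma IsRegularWeight.smoothTail_le (hw : IsRegularWeight w) {C : ℝ} (hC : 0 < C)
    (h : ∀ r ∈ Set.Ico (0 : ℝ) 1, smoothTail w r ≤ C * tail w r) {r s : ℝ} (hr : 0 ≤ r)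
    (hrs : r ≤ s) (hs : s < 1) :
    smoothTail w s ≤ smoothTail w r * ((1 - s) / (1 - r)) ^ C⁻¹ := by
  have hs' : 0 < 1 - s := sub_pos.2 hs
  have hr' : 0 < 1 - r := by linarith
  have h := antitoneOn_mul_one_sub_rpow_neg (κ := C⁻¹) hw.continuousOn_smoothTail
    (fun r hr => hw.hasDerivAt_smoothTail hr) (fun t ht => by
      have ht' : 1 - t ≠ 0 := (sub_pos.2 ht.2).ne'
      have := (inv_mul_le_iff₀ hC).2 (h t (Set.Ioo_subset_Ico_self ht))
      rw [mul_neg, mul_div_cancel₀ _ ht', neg_mul]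
      exact neg_le_neg this) ⟨hr, hrs.trans_lt hs⟩ ⟨hr.trans hrs, hs⟩ hrs
  simp only [Real.rpow_neg hs'.le, Real.rpow_neg hr'.le, ← div_eq_mul_inv] at h
  rw [Real.div_rpow hs'.le hr'.le, mul_div_left_comm, mul_comm]
  exact (div_le_iff₀ (by positivity)).1 h

lemma IsRegularWeight.le_smoothTail (hw : IsRegularWeight w) {c : ℝ} (hc : 0 < c)
    (h : ∀ r ∈ Set.Ico (0 : ℝ) 1, c * tail w r ≤ smoothTail w r) {r s : ℝ} (hr : 0 ≤ r)
    (hrs : r ≤ s) (hs : s < 1) :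
    smoothTail w r * ((1 - s) / (1 - r)) ^ c⁻¹ ≤ smoothTail w s := by
  have hs' : 0 < 1 - s := sub_pos.2 hs
  have hr' : 0 < 1 - r := by linarith
  have h := antitoneOn_mul_one_sub_rpow_neg (κ := c⁻¹) hw.continuousOn_smoothTail.neg
    (fun r hr => (hw.hasDerivAt_smoothTail hr).neg) (fun t ht => by
      have ht' : 1 - t ≠ 0 := (sub_pos.2 ht.2).ne'
      have := (le_inv_mul_iff₀ hc).2 (h t (Set.Ioo_subset_Ico_self ht))
      rwa [Pi.neg_apply, neg_neg, neg_mul_neg, mul_div_cancel₀ _ ht'])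
    ⟨hr, hrs.trans_lt hs⟩ ⟨hr.trans hrs, hs⟩ hrs
  simp only [Real.rpow_neg hs'.le, Real.rpow_neg hr'.le, ← div_eq_mul_inv, Pi.neg_apply, neg_div,
    neg_le_neg_iff] at h
  rw [Real.div_rpow hs'.le hr'.le, mul_div_left_comm, mul_comm]
  exact (le_div_iff₀ (by positivity)).1 h

lemma IsRegularWeight.exists_mul_one_sub_bounds (hw : IsRegularWeight w) :
    ∃ α > (0 : ℝ), ∃ β : ℝ, ∃ K > 0, ∀ r s : ℝ, 0 ≤ r → r ≤ s → s < 1 →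
      w s * (1 - s) ≤ K * (w r * (1 - r) * ((1 - s) / (1 - r)) ^ α) ∧
        w r * (1 - r) * ((1 - s) / (1 - r)) ^ β ≤ K * (w s * (1 - s)) := by
  obtain ⟨c, C, hc, hC, h⟩ := hw.exists_smoothTail_bounds
  refine ⟨C⁻¹, inv_pos.2 hC, c⁻¹, (C / c) ^ 2, by positivity, fun r s hr hrs hs => ?_⟩
  have hs' : 0 < 1 - s := sub_pos.2 hs
  have hr' : 0 < 1 - r := by linarith
  have hle := hw.smoothTail_le hC (fun t ht => (h t ht).2.2) hr hrs hs
  have hge := hw.le_smoothTail hc (fun t ht => (h t ht).2.1) hr hrs hs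
  obtain ⟨⟨hwr, hwr'⟩, hTr, hTr'⟩ := h r ⟨hr, hrs.trans_lt hs⟩
  obtain ⟨⟨hws, hws'⟩, hTs, hTs'⟩ := h s ⟨hr.trans hrs, hs⟩
  rw [le_div_iff₀ hr'] at hwr
  rw [le_div_iff₀ hs'] at hws
  rw [div_le_iff₀ hr'] at hwr'
  rw [div_le_iff₀ hs'] at hws'
  rw [div_pow, div_mul_eq_mul_div, div_mul_eq_mul_div, le_div_iff₀ (by positivity),
    le_div_iff₀ (by positivity)]
  set x := (1 - s) / (1 - r)
  have : 0 < x := div_pos hs' hr'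
  constructor
  · calc w s * (1 - s) * c ^ 2 = c * (c * w s * (1 - s)) := by ring
      _ ≤ c * tail w s := by gcongr
      _ ≤ smoothTail w r * x ^ C⁻¹ := hTs.trans hle
      _ ≤ C * (C * w r * (1 - r)) * x ^ C⁻¹ := by gcongr; exact hTr'.trans (by gcongr)
      _ = C ^ 2 * (w r * (1 - r) * x ^ C⁻¹) := by ring
  · calc w r * (1 - r) * x ^ c⁻¹ * c ^ 2 = c * (c * w r * (1 - r)) * x ^ c⁻¹ := by ring
      _ ≤ smoothTail w r * x ^ c⁻¹ := by gcongr; exact le_trans (by gcongr) hTr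
      _ ≤ C * tail w s := hge.trans hTs'
      _ ≤ C * (C * w s * (1 - s)) := by gcongr
      _ = C ^ 2 * (w s * (1 - s)) := by ring

theorem IsRegularWeight.exists_isPowerWeight (hw : IsRegularWeight w) :
    ∃ α β, IsPowerWeight α β w := by
  obtain ⟨α, hα, β, K, hK, h⟩ := hw.exists_mul_one_sub_bounds
  refine ⟨α, β, hα, hw.pos, hw.integrableOn.aemeasurable, K, hK, fun r s hr hrs hs => ?_⟩
  obtain ⟨hle, hge⟩ := h r s hr hrs hs
  have hs' : 0 < 1 - s := sub_pos.2 hs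
  have hr' : 0 < 1 - r := by linarith
  rw [Real.rpow_sub_one (by positivity), Real.rpow_sub_one (by positivity)]
  constructor
  · refine le_of_mul_le_mul_right (hle.trans_eq ?_) hs'
    field_simp
  · refine le_of_mul_le_mul_right (Eq.trans_le ?_ (hge.trans_eq (mul_assoc _ _ _).symm)) hs'
    field_simp

end RegularWeight

section PowerWeight

lemma rpow_le_two_rpow_abs {x : ℝ} (hx : 2⁻¹ ≤ x) (hx' : x ≤ 2) (y : ℝ) : x ^ y ≤ 2 ^ |y| := by
  have hx0 : 0 < x := lt_of_lt_of_le (by norm_num) hx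
  rcases le_total 0 y with hy | hy
  · rw [abs_of_nonneg hy]
    exact Real.rpow_le_rpow hx0.le hx' hy
  · rw [abs_of_nonpos hy, ← inv_inv x, Real.inv_rpow (inv_nonneg.2 hx0.le),
      ← Real.rpow_neg (inv_nonneg.2 hx0.le)]
    exact Real.rpow_le_rpow (by positivity) (inv_le_of_inv_le₀ two_pos hx) (neg_nonneg.2 hy)

variable {α β : ℝ} {w : ℝ → ℝ}

lemma IsPowerWeight.exists_le_mul_of_comparable (hw : IsPowerWeight α β w) :
    ∃ C > 0, ∀ r ∈ Set.Ico (0 : ℝ) 1, ∀ s ∈ Set.Ico (0 : ℝ) 1,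
      1 - r ≤ 2 * (1 - s) → 1 - s ≤ 2 * (1 - r) → w r ≤ C * w s := by
  obtain ⟨K, hK, h⟩ := hw.exists_bounds
  refine ⟨max (K * 2 ^ |α - 1|) (K * 2 ^ |1 - β|), by positivity,
    fun r ⟨hr, hr1⟩ s ⟨hs, hs1⟩ hrs hsr => ?_⟩
  have := hw.pos r ⟨hr, hr1⟩
  have hws := hw.pos s ⟨hs, hs1⟩
  have hr' : 0 < 1 - r := sub_pos.2 hr1
  have hs' : 0 < 1 - s := sub_pos.2 hs1
  rcases le_total s r with hle | hle
  · calc w r ≤ K * (w s * ((1 - r) / (1 - s)) ^ (α - 1)) := (h s r hs hle hr1).1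
      _ ≤ K * (w s * 2 ^ |α - 1|) := by
        gcongr
        exact rpow_le_two_rpow_abs ((le_div_iff₀ hs').2 (by linarith)) ((div_le_iff₀ hs').2 hrs) _
      _ = K * 2 ^ |α - 1| * w s := by ring
      _ ≤ _ := by gcongr; exact le_max_left _ _
  · set x := (1 - s) / (1 - r)
    have hx : 0 < x := div_pos hs' hr'
    calc w r = w r * x ^ (β - 1) * x ^ (1 - β) := by
          rw [mul_assoc, ← Real.rpow_add hx]; simp
      _ ≤ K * w s * 2 ^ |1 - β| := by
        refine mul_le_mul (h r s hr hle hs1).2 ?_ (by positivity) (by positivity)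
        exact rpow_le_two_rpow_abs ((le_div_iff₀ hr').2 (by linarith)) ((div_le_iff₀ hr').2 hsr) _
      _ = K * 2 ^ |1 - β| * w s := by ring
      _ ≤ _ := by gcongr; exact le_max_right _ _

lemma IsPowerWeight.mul_one_sub_rpow (hw : IsPowerWeight α β w) {x : ℝ} (hx : 0 < α + x) :
    IsPowerWeight (α + x) (β + x) fun r => w r * (1 - r) ^ x := by
  obtain ⟨K, hK, h⟩ := hw.exists_bounds
  refine ⟨hx, fun r hr => mul_pos (hw.pos r hr) (Real.rpow_pos_of_pos (sub_pos.2 hr.2) _),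
    hw.aemeasurable.mul (by fun_prop), K, hK, fun r s hr hrs hs => ?_⟩
  obtain ⟨hle, hge⟩ := h r s hr hrs hs
  have hs' : 0 < 1 - s := sub_pos.2 hs
  have hr' : 0 < 1 - r := by linarith
  have key : ∀ a : ℝ, w r * (1 - r) ^ x * ((1 - s) / (1 - r)) ^ (a + x - 1) =
      w r * ((1 - s) / (1 - r)) ^ (a - 1) * (1 - s) ^ x := fun a => by
    rw [add_sub_right_comm, Real.rpow_add (by positivity), Real.div_rpow hs'.le hr'.le (z := x)]
    field_simp
  have hsx : 0 ≤ (1 - s) ^ x := by positivity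
  rw [key, key]
  exact ⟨(mul_le_mul_of_nonneg_right hle hsx).trans_eq (mul_assoc _ _ _),
    (mul_le_mul_of_nonneg_right hge hsx).trans_eq (mul_assoc _ _ _)⟩

lemma isPowerWeight_one : IsPowerWeight 1 1 fun _ => 1 :=
  ⟨one_pos, fun _ _ => one_pos, aemeasurable_const, 1, one_pos, by simp⟩

lemma isPowerWeight_one_sub_rpow {x : ℝ} (hx : -1 < x) :
    IsPowerWeight (1 + x) (1 + x) fun r => (1 - r) ^ x := by
  simpa using isPowerWeight_one.mul_one_sub_rpow (x := x) (by linarith)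

lemma prod_mul_rpow_sub_one {κ : Type*} [Fintype κ] {u θ a : κ → ℝ} (hu : ∀ i, 0 ≤ u i)
    (hθ : ∑ i, θ i = 1) {x : ℝ} (hx : 0 < x) :
    ∏ i, (u i * x ^ (a i - 1)) ^ θ i = (∏ i, u i ^ θ i) * x ^ (∑ i, θ i * a i - 1) := by
  calc ∏ i, (u i * x ^ (a i - 1)) ^ θ i = ∏ i, u i ^ θ i * x ^ (θ i * a i - θ i) := by
        refine Finset.prod_congr rfl fun i _ => ?_
        rw [Real.mul_rpow (hu i) (by positivity), ← Real.rpow_mul hx.le]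
        ring_nf
    _ = (∏ i, u i ^ θ i) * x ^ (∑ i, θ i * a i - 1) := by
        rw [Finset.prod_mul_distrib, ← Real.rpow_sum_of_pos hx, Finset.sum_sub_distrib, hθ]

theorem IsPowerWeight.prod_rpow {κ : Type*} [Fintype κ] {α β θ : κ → ℝ} {w : κ → ℝ → ℝ}
    (hw : ∀ i, IsPowerWeight (α i) (β i) (w i)) (hθ : ∀ i, 0 ≤ θ i) (hsum : ∑ i, θ i = 1) :
    IsPowerWeight (∑ i, θ i * α i) (∑ i, θ i * β i) fun r => ∏ i, w i r ^ θ i := by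
  choose K hK h using fun i => (hw i).exists_bounds
  obtain ⟨j, -, hj⟩ := Finset.exists_ne_zero_of_sum_ne_zero (hsum.trans_ne one_ne_zero)
  have hj' : 0 < θ j * α j := mul_pos ((hθ j).lt_of_ne' hj) (hw j).exponent_pos
  refine ⟨Finset.sum_pos' (fun i _ => mul_nonneg (hθ i) (hw i).exponent_pos.le)
      ⟨j, Finset.mem_univ j, hj'⟩,
    fun r hr => Finset.prod_pos fun i _ => Real.rpow_pos_of_pos ((hw i).pos r hr) _,
    Finset.aemeasurable_fun_prod _ fun i _ => (hw i).aemeasurable.pow_const _,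
    ∏ i, K i ^ θ i, Finset.prod_pos fun i _ => Real.rpow_pos_of_pos (hK i) _,
    fun r s hr hrs hs => ?_⟩
  have hx : 0 < (1 - s) / (1 - r) := div_pos (sub_pos.2 hs) (by linarith)
  have hwr : ∀ i, 0 ≤ w i r := fun i => ((hw i).pos r ⟨hr, hrs.trans_lt hs⟩).le
  have hws : ∀ i, 0 ≤ w i s := fun i => ((hw i).pos s ⟨hr.trans hrs, hs⟩).le
  simp only [← prod_mul_rpow_sub_one hwr hsum hx, ← Finset.prod_mul_distrib]
  constructor <;> refine Finset.prod_le_prod (fun i _ => ?_) fun i _ => ?_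
  · exact Real.rpow_nonneg (hws i) _
  · rw [← Real.mul_rpow (hK i).le (mul_nonneg (hwr i) (by positivity))]
    exact Real.rpow_le_rpow (hws i) (h i r s hr hrs hs).1 (hθ i)
  · exact Real.rpow_nonneg (mul_nonneg (hwr i) (by positivity)) _
  · rw [← Real.mul_rpow (hK i).le (hws i)]
    exact Real.rpow_le_rpow (mul_nonneg (hwr i) (by positivity)) (h i r s hr hrs hs).2 (hθ i)

end PowerWeight

section Whitney

/-- The Whitney ball of a point of the disc, of radius half the distance to the unit circle; the
weights, and the subharmonic functions `‖f‖ ^ p`, are controlled on it by their values at `a`. -/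
def whitneyBall (a : ℂ) : Set ℂ := Metric.ball a ((1 - ‖a‖) / 2)

/-- The concentric half of `whitneyBall a`. -/
def whitneyCell (a : ℂ) : Set ℂ := Metric.closedBall a ((1 - ‖a‖) / 4)

/-- A set of points of the disc whose Whitney cells cover the disc, while at most `N` of the twice
larger Whitney balls have a point in common. -/
structure IsWhitneyLattice (Λ : Set ℂ) (N : ℕ) : Prop where
  countable : Λ.Countable
  subset_disc : Λ ⊆ disc
  disc_subset : disc ⊆ ⋃ a ∈ Λ, whitneyCell a
  card_le : ∀ z ∈ disc, ∀ s : Finset ℂ, (∀ a ∈ s, a ∈ Λ ∧ z ∈ whitneyBall a) → s.card ≤ N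

lemma abs_norm_sub_norm_lt_of_mem_whitneyBall {a z : ℂ} (hz : z ∈ whitneyBall a) :
    |‖z‖ - ‖a‖| < (1 - ‖a‖) / 2 :=
  (abs_norm_sub_norm_le z a).trans_lt (mem_ball_iff_norm.1 hz)

lemma whitneyBall_subset_disc (a : ℂ) : whitneyBall a ⊆ disc := fun z hz => by
  have h := abs_lt.1 (abs_norm_sub_norm_lt_of_mem_whitneyBall hz)
  rw [mem_ball_zero_iff]
  linarith

lemma mem_whitneyCell_self {a : ℂ} (ha : a ∈ disc) : a ∈ whitneyCell a :=
  Metric.mem_closedBall_self (by linarith [mem_ball_zero_iff.1 ha])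

lemma whitneyCell_subset_whitneyBall {a : ℂ} (ha : a ∈ disc) : whitneyCell a ⊆ whitneyBall a :=
  Metric.closedBall_subset_ball (by rw [mem_ball_zero_iff] at ha; linarith)

lemma ball_subset_whitneyBall {a z : ℂ} (hz : z ∈ whitneyCell a) :
    Metric.ball z ((1 - ‖a‖) / 4) ⊆ whitneyBall a :=
  Metric.ball_subset_ball' (by rw [whitneyCell, Metric.mem_closedBall] at hz; linarith)

lemma card_le_of_pairwiseDisjoint_closedBall {s : Finset ℂ} {ρ : ℂ → ℝ} {z : ℂ} {δ : ℝ}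
    (hδ : 0 < δ) (hs : (s : Set ℂ).PairwiseDisjoint fun a => Metric.closedBall a (ρ a))
    (h : ∀ a ∈ s, dist a z < δ ∧ δ / 30 ≤ ρ a) : s.card ≤ 961 := by
  have hdisj : (s : Set ℂ).PairwiseDisjoint fun a => Metric.ball a (δ / 30) :=
    hs.mono_on fun a ha => Metric.ball_subset_closedBall.trans
      (Metric.closedBall_subset_closedBall (h a ha).2)
  have hsub : (⋃ a ∈ s, Metric.ball a (δ / 30)) ⊆ Metric.ball z (31 * (δ / 30)) :=
    Set.iUnion₂_subset fun a ha => Metric.ball_subset_ball' (by linarith [(h a ha).1])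
  have hvol := measure_mono (μ := volume) hsub
  rw [measure_biUnion_finset hdisj fun _ _ => measurableSet_ball] at hvol
  have hpos : ENNReal.ofReal (δ / 30) ^ 2 * NNReal.pi ≠ 0 := by
    have : 0 < ENNReal.ofReal (δ / 30) := ENNReal.ofReal_pos.2 (by positivity)
    exact mul_ne_zero (by positivity) (by exact_mod_cast NNReal.pi_ne_zero)
  simp only [Complex.volume_ball, Finset.sum_const, nsmul_eq_mul,
    ENNReal.ofReal_mul' (by positivity : 0 ≤ δ / 30), mul_pow, mul_assoc] at hvol
  rw [ENNReal.mul_le_mul_iff_left hpos (by finiteness)] at hvol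
  have h31 : ENNReal.ofReal 31 ^ 2 = ((961 : ℕ) : ℝ≥0∞) := by norm_num
  exact_mod_cast hvol.trans_eq h31

theorem exists_isWhitneyLattice : ∃ (Λ : Set ℂ) (N : ℕ), IsWhitneyLattice Λ N := by
  obtain ⟨Λ, hΛ, hdisj, hcov⟩ := Vitali.exists_disjoint_subfamily_covering_enlargement_closedBall
    disc id (fun a => (1 - ‖a‖) / 20) 1 (fun a _ => by linarith [norm_nonneg a]) 5 (by norm_num)
  have hlt : ∀ a ∈ disc, 0 < 1 - ‖a‖ := fun a ha => sub_pos.2 (mem_ball_zero_iff.1 ha)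
  refine ⟨Λ, 961, ?_, hΛ, fun z hz => ?_, fun z hz s hs => ?_⟩
  · refine hdisj.countable_of_nonempty_interior fun a ha => ⟨a, ?_⟩
    exact Metric.ball_subset_interior_closedBall
      (Metric.mem_ball_self (by linarith [hlt a (hΛ ha)]))
  · obtain ⟨a, ha, hsub⟩ := hcov z hz
    refine Set.mem_biUnion ha (Metric.closedBall_subset_closedBall ?_
      (hsub (Metric.mem_closedBall_self (by linarith [hlt z hz]))))
    linarith
  · refine card_le_of_pairwiseDisjoint_closedBall (z := z) (hlt z hz)
      (hdisj.subset fun a ha => (hs a ha).1) fun a ha => ?_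
    have h := abs_lt.1 (abs_norm_sub_norm_lt_of_mem_whitneyBall (hs a ha).2)
    have hd := Metric.mem_ball'.1 (hs a ha).2
    constructor <;> linarith

variable {Λ : Set ℂ} {N : ℕ}

lemma IsWhitneyLattice.sum_measure_le (hΛ : IsWhitneyLattice Λ N) (ν : Measure ℂ)
    {s : Finset ℂ} (hs : ↑s ⊆ Λ) : ∑ a ∈ s, ν (whitneyBall a) ≤ N * ν disc := by
  classical
  have hmeas : ∀ a, MeasurableSet (whitneyBall a) := fun a => measurableSet_ball
  calc ∑ a ∈ s, ν (whitneyBall a) = ∫⁻ z, ∑ a ∈ s, (whitneyBall a).indicator 1 z ∂ν := by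
        rw [lintegral_finsetSum _ fun a _ => measurable_one.indicator (hmeas a)]
        simp only [lintegral_indicator_one (hmeas _)]
    _ ≤ ∫⁻ z, disc.indicator (fun _ => (N : ℝ≥0∞)) z ∂ν := by
        refine lintegral_mono fun z => ?_
        by_cases hz : z ∈ disc
        · rw [Set.indicator_of_mem hz, Finset.sum_indicator_eq_sum_filter]
          simpa using hΛ.card_le z hz {a ∈ s | z ∈ whitneyBall a} fun a ha =>
            ⟨hs (Finset.mem_filter.1 ha).1, (Finset.mem_filter.1 ha).2⟩
        · refine (Finset.sum_eq_zero fun a _ => Set.indicator_of_notMem ?_ _).trans_le zero_le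
          exact fun h => hz (whitneyBall_subset_disc a h)
    _ = N * ν disc := lintegral_indicator_const measurableSet_ball _

lemma IsWhitneyLattice.sum_setLIntegral_le (hΛ : IsWhitneyLattice Λ N) (ν : Measure ℂ)
    (g : ℂ → ℝ≥0∞) {s : Finset ℂ} (hs : ↑s ⊆ Λ) :
    ∑ a ∈ s, ∫⁻ z in whitneyBall a, g z ∂ν ≤ N * ∫⁻ z in disc, g z ∂ν := by
  have h := hΛ.sum_measure_le (ν.withDensity g) hs
  rwa [withDensity_apply _ measurableSet_ball,
    Finset.sum_congr rfl fun a _ =>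
      withDensity_apply (s := whitneyBall a) g measurableSet_ball] at h

end Whitney

section Submean

variable {f : ℂ → ℂ} {c : ℂ} {r p : ℝ}

lemma log_norm_le_circleAverage (hr : 0 < r) (hf : AnalyticOnNhd ℂ f (Metric.closedBall c r))
    (hc : f c ≠ 0) : Real.log ‖f c‖ ≤ Real.circleAverage (fun z => Real.log ‖f z‖) c r := by
  rw [← abs_of_pos hr] at hf
  rw [hf.circleAverage_log_norm hr.ne' hc]
  refine le_add_of_nonneg_left (finsum_nonneg fun u => ?_)
  by_cases hu : u ∈ Metric.closedBall c |r|
  · refine mul_nonneg (Int.cast_nonneg (MeromorphicOn.AnalyticOnNhd.divisor_nonneg hf u)) ?_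
    rcases eq_or_ne u c with rfl | huc
    · simp
    · rw [mem_closedBall_iff_norm', abs_of_pos hr] at hu
      refine Real.log_nonneg ?_
      rwa [← div_eq_mul_inv, one_le_div (norm_pos_iff.2 (sub_ne_zero.2 huc.symm))]
  · simp [hu]

lemma add_mul_log_le_rpow {x y : ℝ} (hx : 0 < x) (hy : 0 < y) :
    x ^ p * (1 - p * Real.log x) + x ^ p * p * Real.log y ≤ y ^ p := by
  calc x ^ p * (1 - p * Real.log x) + x ^ p * p * Real.log y
      = x ^ p * (p * (Real.log y - Real.log x) + 1) := by ring
    _ ≤ x ^ p * Real.exp (p * (Real.log y - Real.log x)) := by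
        gcongr
        exact Real.add_one_le_exp _
    _ = y ^ p := by
        rw [Real.rpow_def_of_pos hx, Real.rpow_def_of_pos hy, ← Real.exp_add]
        ring_nf

/- Jensen's formula makes `log ‖f‖` subharmonic; the tangent to `exp` at `p * log ‖f c‖` carries
this over to `‖f‖ ^ p`. The zeros of `f` on the circle, where `Real.log 0 = 0` spoils the tangent
bound, are discrete. -/
theorem norm_rpow_le_circleAverage (hr : 0 < r) (hf : AnalyticOnNhd ℂ f (Metric.closedBall c r))
    (hp : 0 < p) : ‖f c‖ ^ p ≤ Real.circleAverage (fun z => ‖f z‖ ^ p) c r := by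
  rcases eq_or_ne (f c) 0 with hc | hc
  · rw [hc, norm_zero, Real.zero_rpow hp.ne']
    exact Real.circleAverage_nonneg_of_nonneg fun z _ => by positivity
  have hsphere : Metric.sphere c |r| ⊆ Metric.closedBall c r := by
    rw [abs_of_pos hr]; exact Metric.sphere_subset_closedBall
  set A := ‖f c‖ ^ p * (1 - p * Real.log ‖f c‖)
  set B := ‖f c‖ ^ p * p
  set g : ℂ → ℝ := fun z => A + B * Real.log ‖f z‖
  have hlog : CircleIntegrable (fun z => Real.log ‖f z‖) c r :=
    MeromorphicOn.circleIntegrable_log_norm (hf.mono hsphere).meromorphicOn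
  have hlog' : CircleIntegrable (fun z => B * Real.log ‖f z‖) c r := hlog.const_mul B
  have hrpow : CircleIntegrable (fun z => ‖f z‖ ^ p) c r :=
    ((hf.continuousOn.mono Metric.sphere_subset_closedBall).norm.rpow_const
      fun _ _ => Or.inr hp.le).circleIntegrable hr.le
  have hmin : g =ᶠ[codiscreteWithin (Metric.sphere c |r|)] fun z => min (g z) (‖f z‖ ^ p) := by
    filter_upwards [codiscreteWithin_mono hsphere (hf.preimage_zero_mem_codiscreteWithin hc
      (Metric.mem_closedBall_self hr.le) (Metric.isConnected_closedBall hr.le))] with z hz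
    exact (min_eq_left (add_mul_log_le_rpow (norm_pos_iff.2 hc) (norm_pos_iff.2 hz))).symm
  calc ‖f c‖ ^ p = A + B * Real.log ‖f c‖ := by ring
    _ ≤ A + B * Real.circleAverage (fun z => Real.log ‖f z‖) c r := by
        gcongr
        exact log_norm_le_circleAverage hr hf hc
    _ = Real.circleAverage g c r := by
        rw [Real.circleAverage_fun_add (circleIntegrable_const A c r) hlog',
          Real.circleAverage_const]
        exact congrArg (A + ·)
          (Real.circleAverage_fun_smul (a := B) (f := fun z => Real.log ‖f z‖)).symm
    _ = Real.circleAverage (fun z => min (g z) (‖f z‖ ^ p)) c r :=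
        Real.circleAverage_congr_codiscreteWithin hmin hr.ne'
    _ ≤ Real.circleAverage (fun z => ‖f z‖ ^ p) c r :=
        Real.circleAverage_mono
          ((circleIntegrable_const A c r).add hlog' |>.congr_codiscreteWithin hmin) hrpow
          fun z _ => min_le_right _ _

lemma two_pi_mul_enorm_rpow_le (hr : 0 < r) (hf : AnalyticOnNhd ℂ f (Metric.closedBall c r))
    (hp : 0 < p) : ENNReal.ofReal (2 * Real.pi) * ‖f c‖ₑ ^ p ≤
      ∫⁻ θ in Set.Ioo (-Real.pi) Real.pi, ‖f (circleMap c r θ)‖ₑ ^ p := by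
  have hcont : Continuous fun θ => ‖f (circleMap c r θ)‖ ^ p :=
    (hf.continuousOn.comp_continuous (continuous_circleMap c r) fun θ =>
      circleMap_mem_closedBall c hr.le θ).norm.rpow_const fun _ => Or.inr hp.le
  have hofReal : ∀ z, ‖f z‖ₑ ^ p = ENNReal.ofReal (‖f z‖ ^ p) := fun z => by
    rw [← ofReal_norm, ENNReal.ofReal_rpow_of_nonneg (norm_nonneg _) hp.le]
  have havg := norm_rpow_le_circleAverage hr hf hp
  rw [Real.circleAverage_eq_integral_add (-Real.pi), smul_eq_mul,
    le_inv_mul_iff₀ (by positivity),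
    intervalIntegral.integral_comp_add_right fun θ => ‖f (circleMap c r θ)‖ ^ p, zero_add,
    two_mul, add_neg_cancel_right, intervalIntegral.integral_of_le (by linarith [Real.pi_pos]),
    integral_Ioc_eq_integral_Ioo, ← two_mul] at havg
  simp only [hofReal]
  rw [← ENNReal.ofReal_mul (by positivity), ← ofReal_integral_eq_lintegral_ofReal
    (hcont.integrableOn_Icc.mono_set Set.Ioo_subset_Icc_self)
    (Eventually.of_forall fun θ => by positivity)]
  exact ENNReal.ofReal_le_ofReal havg

lemma setLIntegral_ball_eq_polar (g : ℂ → ℝ≥0∞) (c : ℂ) (d : ℝ) :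
    ∫⁻ z in Metric.ball c d, g z = ∫⁻ x in Set.Ioo 0 d ×ˢ Set.Ioo (-Real.pi) Real.pi,
      ENNReal.ofReal x.1 * g (circleMap c x.1 x.2) := by
  have hpolar : ∀ x : ℝ × ℝ, c + Complex.polarCoord.symm x = circleMap c x.1 x.2 := fun x => by
    rw [Complex.polarCoord_symm_apply, circleMap, Complex.exp_mul_I]
    push_cast; rfl
  have htarget : Set.Ioo 0 d ×ˢ Set.Ioo (-Real.pi) Real.pi =
      Set.Iio d ×ˢ Set.univ ∩ polarCoord.target := by
    rw [polarCoord_target, Set.prod_inter_prod, Set.univ_inter, Set.inter_comm, Set.Ioi_inter_Iio]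
  rw [← lintegral_indicator measurableSet_ball,
    ← lintegral_add_left_eq_self _ c, ← Complex.lintegral_comp_polarCoord_symm, htarget,
    ← Measure.restrict_restrict (measurableSet_Iio.prod MeasurableSet.univ),
    ← lintegral_indicator (measurableSet_Iio.prod MeasurableSet.univ)]
  refine setLIntegral_congr_fun polarCoord.open_target.measurableSet fun x hx => ?_
  have hmem : circleMap c x.1 x.2 ∈ Metric.ball c d ↔ x ∈ Set.Iio d ×ˢ (Set.univ : Set ℝ) := by
    rw [mem_ball_iff_norm, circleMap_sub_center, norm_circleMap_zero, abs_of_pos hx.1]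
    simp
  simp only [hpolar, smul_eq_mul]
  by_cases hxd : x ∈ Set.Iio d ×ˢ (Set.univ : Set ℝ)
  · rw [Set.indicator_of_mem hxd, Set.indicator_of_mem (hmem.2 hxd)]
  · rw [Set.indicator_of_notMem hxd, Set.indicator_of_notMem (mt hmem.1 hxd), mul_zero]

lemma setLIntegral_Ioo_ofReal {d : ℝ} (hd : 0 ≤ d) :
    ∫⁻ r in Set.Ioo 0 d, ENNReal.ofReal r = ENNReal.ofReal (d ^ 2 / 2) := by
  rw [← ofReal_integral_eq_lintegral_ofReal
    (continuous_id'.integrableOn_Icc (a := 0) (b := d).mono_set Set.Ioo_subset_Icc_self)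
    ((ae_restrict_iff' measurableSet_Ioo).2 (Eventually.of_forall fun x hx => hx.1.le)),
    ← integral_Ioc_eq_integral_Ioo, ← intervalIntegral.integral_of_le hd]
  simp

theorem ofReal_mul_enorm_rpow_le_setLIntegral_ball {d : ℝ} (hd : 0 ≤ d)
    (hf : DifferentiableOn ℂ f (Metric.ball c d)) (hp : 0 < p) :
    ENNReal.ofReal (Real.pi * d ^ 2) * ‖f c‖ₑ ^ p ≤ ∫⁻ z in Metric.ball c d, ‖f z‖ₑ ^ p := by
  have hmaps : Set.MapsTo (fun x : ℝ × ℝ => circleMap c x.1 x.2)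
      (Set.Ioo 0 d ×ˢ Set.Ioo (-Real.pi) Real.pi) (Metric.ball c d) := fun x hx => by
    rw [mem_ball_iff_norm, circleMap_sub_center, norm_circleMap_zero, abs_of_pos hx.1.1]
    exact hx.1.2
  have hmeas : AEMeasurable (fun x : ℝ × ℝ => ENNReal.ofReal x.1 * ‖f (circleMap c x.1 x.2)‖ₑ ^ p)
      ((volume.restrict (Set.Ioo 0 d)).prod (volume.restrict (Set.Ioo (-Real.pi) Real.pi))) := by
    rw [Measure.prod_restrict]
    have hcirc : ContinuousOn (fun x : ℝ × ℝ => f (circleMap c x.1 x.2))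
        (Set.Ioo 0 d ×ˢ Set.Ioo (-Real.pi) Real.pi) :=
      hf.continuousOn.comp (by unfold circleMap; fun_prop) hmaps
    exact (ENNReal.measurable_ofReal.comp measurable_fst).aemeasurable.mul
      ((hcirc.aemeasurable (measurableSet_Ioo.prod measurableSet_Ioo)).enorm.pow_const p)
  rw [setLIntegral_ball_eq_polar, Measure.volume_eq_prod, ← Measure.prod_restrict,
    lintegral_prod _ hmeas]
  calc ENNReal.ofReal (Real.pi * d ^ 2) * ‖f c‖ₑ ^ p
      = ∫⁻ r in Set.Ioo 0 d, ENNReal.ofReal r * (ENNReal.ofReal (2 * Real.pi) * ‖f c‖ₑ ^ p) := by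
        rw [lintegral_mul_const _ ENNReal.measurable_ofReal, setLIntegral_Ioo_ofReal hd,
          ← mul_assoc, ← ENNReal.ofReal_mul (by positivity)]
        congr 2
        ring
    _ ≤ _ := by
        refine setLIntegral_mono' measurableSet_Ioo fun r hr => ?_
        rw [lintegral_const_mul' _ _ ENNReal.ofReal_ne_top]
        gcongr
        exact two_pi_mul_enorm_rpow_le hr.1 (hf.analyticOnNhd Metric.isOpen_ball |>.mono
          (Metric.closedBall_subset_ball hr.2)) hp

end Submean

section WeightedArea

lemma quasiMeasurePreserving_norm_disc : Measure.QuasiMeasurePreserving (fun z : ℂ => ‖z‖)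
    (volume.restrict disc) (volume.restrict (Set.Ico 0 1)) := by
  refine ⟨measurable_norm, Measure.AbsolutelyContinuous.mk fun s hs hs0 => ?_⟩
  have hae : ∀ᵐ r ∂volume.restrict (Set.Ioo (0 : ℝ) 1), r ∉ s := by
    rw [Measure.restrict_congr_set Ioo_ae_eq_Ico]
    exact measure_eq_zero_iff_ae_notMem.1 hs0
  rw [Measure.map_apply measurable_norm hs, ← lintegral_indicator_one (measurable_norm hs),
    setLIntegral_ball_eq_polar, Measure.volume_eq_prod, ← Measure.prod_restrict,
    ← nonpos_iff_eq_zero]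
  refine (lintegral_prod_le _).trans_eq (lintegral_eq_zero_of_ae_eq_zero ?_)
  filter_upwards [hae, ae_restrict_mem measurableSet_Ioo] with r hr hr0
  simp [Set.indicator, abs_of_pos hr0.1, hr]

variable {w : ℝ → ℝ}

lemma aemeasurable_radial (hw : AEMeasurable w (volume.restrict (Set.Ico 0 1))) :
    AEMeasurable (fun z : ℂ => ENNReal.ofReal (w ‖z‖)) discArea :=
  (hw.comp_quasiMeasurePreserving quasiMeasurePreserving_norm_disc).ennreal_ofReal.smul_measure _

lemma weightedArea_restrict_disc : (weightedArea w).restrict disc = weightedArea w := by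
  rw [weightedArea, restrict_withDensity measurableSet_ball, discArea, Measure.restrict_smul,
    Measure.restrict_restrict measurableSet_ball, Set.inter_self]

lemma setLIntegral_weightedArea (hw : AEMeasurable w (volume.restrict (Set.Ico 0 1)))
    (g : ℂ → ℝ≥0∞) {s : Set ℂ} (hs : MeasurableSet s) (hsub : s ⊆ disc) :
    ∫⁻ z in s, g z ∂weightedArea w =
      ENNReal.ofReal Real.pi⁻¹ * ∫⁻ z in s, ENNReal.ofReal (w ‖z‖) * g z := by
  rw [weightedArea, setLIntegral_withDensity_eq_setLIntegral_mul_non_measurable₀ _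
    (aemeasurable_radial hw).restrict _ hs (Eventually.of_forall fun z => ENNReal.ofReal_lt_top),
    discArea, Measure.restrict_smul, Measure.restrict_restrict hs, Set.inter_eq_left.2 hsub,
    lintegral_smul_measure, smul_eq_mul]
  rfl

lemma lintegral_weightedArea (hw : AEMeasurable w (volume.restrict (Set.Ico 0 1)))
    (g : ℂ → ℝ≥0∞) :
    ∫⁻ z, g z ∂weightedArea w =
      ENNReal.ofReal Real.pi⁻¹ * ∫⁻ z in disc, ENNReal.ofReal (w ‖z‖) * g z := by
  rw [← setLIntegral_weightedArea hw g measurableSet_ball subset_rfl, weightedArea_restrict_disc]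

lemma bergmanNorm_rpow {p : ℝ} (hp : 0 < p) (f : ℂ → ℂ) :
    bergmanNorm p w f ^ p = ∫⁻ z, ‖f z‖ₑ ^ p ∂weightedArea w := by
  rw [bergmanNorm, eLpNorm_eq_lintegral_rpow_enorm_toReal (ENNReal.ofReal_ne_zero_iff.2 hp)
    ENNReal.ofReal_ne_top, ENNReal.toReal_ofReal hp.le, ← ENNReal.rpow_mul,
    one_div_mul_cancel hp.ne', ENNReal.rpow_one]

end WeightedArea

section Kernel

lemma one_sub_add_abs_le_mul_norm {t θ : ℝ} (ht : t ∈ Set.Ico 0 1) (hθ : |θ| ≤ Real.pi) :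
    (1 - t) + |θ| ≤ 5 * ‖1 - circleMap 0 t θ‖ := by
  set x := ‖1 - circleMap 0 t θ‖
  have hnorm : ‖circleMap 0 t θ‖ = t := by rw [norm_circleMap_zero, abs_of_nonneg ht.1]
  have hradial : 1 - t ≤ x := by
    simpa [hnorm] using norm_sub_norm_le (1 : ℂ) (circleMap 0 t θ)
  have hdist : ‖circleMap 0 1 θ - 1‖ ≤ (1 - t) + x := by
    calc ‖circleMap 0 1 θ - 1‖ = ‖circleMap 0 (1 - t) θ - (1 - circleMap 0 t θ)‖ := by
          congr 1
          simp only [circleMap]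
          push_cast
          ring
      _ ≤ (1 - t) + x := by
          refine (norm_sub_le _ _).trans_eq ?_
          rw [norm_circleMap_zero, abs_of_pos (sub_pos.2 ht.2)]
  have hjordan : 2 / Real.pi * |θ| ≤ ‖circleMap 0 1 θ - 1‖ := by
    have := Real.mul_abs_le_abs_sin (x := θ / 2) (by rw [abs_div, abs_two]; linarith)
    rw [circleMap_zero, Complex.ofReal_one, one_mul, mul_comm (θ : ℂ),
      Complex.norm_exp_I_mul_ofReal_sub_one, norm_mul, Real.norm_eq_abs, Real.norm_eq_abs, abs_two]
    rw [abs_div, abs_two] at this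
    linarith
  have hangle : |θ| ≤ Real.pi * x := by
    have : 2 / Real.pi * |θ| ≤ 2 * x := by linarith
    rw [div_mul_eq_mul_div, div_le_iff₀ Real.pi_pos] at this
    linarith
  nlinarith [Real.pi_lt_four, norm_nonneg (1 - circleMap 0 t θ)]

lemma lintegral_comp_div {δ : ℝ} (hδ : 0 < δ) (g : ℝ → ℝ≥0∞) :
    ∫⁻ x, g (x / δ) = ENNReal.ofReal δ * ∫⁻ x, g x := by
  have hmap : ∫⁻ x, g (x / δ) = ∫⁻ y, g y ∂Measure.map (· * δ⁻¹) volume :=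
    (lintegral_map_equiv g (Homeomorph.mulRight₀ δ⁻¹ (inv_ne_zero hδ.ne')).toMeasurableEquiv).symm
  rw [hmap, Real.map_volume_mul_right (inv_ne_zero hδ.ne'), inv_inv, abs_of_pos hδ,
    lintegral_smul_measure, smul_eq_mul]

lemma exists_lintegral_norm_one_sub_circleMap_le {γ : ℝ} (hγ : 1 < γ) :
    ∃ C : ℝ≥0∞, C ≠ ∞ ∧ ∀ t ∈ Set.Ico (0 : ℝ) 1,
      ∫⁻ θ in Set.Ioo (-Real.pi) Real.pi, ENNReal.ofReal (‖1 - circleMap 0 t θ‖ ^ (-γ)) ≤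
        C * ENNReal.ofReal ((1 - t) ^ (1 - γ)) := by
  refine ⟨ENNReal.ofReal (5 ^ γ) * ∫⁻ x : ℝ, ENNReal.ofReal ((1 + ‖x‖) ^ (-γ)),
    ENNReal.mul_ne_top ENNReal.ofReal_ne_top
      (finite_integral_one_add_norm (by simpa using hγ)).ne, fun t ht => ?_⟩
  have hδ : 0 < 1 - t := sub_pos.2 ht.2
  calc _ ≤ ∫⁻ θ in Set.Ioo (-Real.pi) Real.pi, ENNReal.ofReal (5 ^ γ * (1 - t) ^ (-γ)) *
        ENNReal.ofReal ((1 + ‖θ / (1 - t)‖) ^ (-γ)) := by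
        refine setLIntegral_mono' measurableSet_Ioo fun θ hθ => ?_
        rw [← ENNReal.ofReal_mul (by positivity)]
        refine ENNReal.ofReal_le_ofReal ?_
        have hle := one_sub_add_abs_le_mul_norm ht (abs_le.2 ⟨hθ.1.le, hθ.2.le⟩)
        have hscale : (1 - t) * (1 + ‖θ / (1 - t)‖) = (1 - t) + |θ| := by
          rw [norm_div, Real.norm_eq_abs, Real.norm_of_nonneg hδ.le]
          field_simp
        calc ‖1 - circleMap 0 t θ‖ ^ (-γ) ≤ (5⁻¹ * ((1 - t) + |θ|)) ^ (-γ) :=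
              Real.rpow_le_rpow_of_nonpos (by positivity) (by linarith) (by linarith)
          _ = _ := by
              rw [← hscale, Real.mul_rpow (by positivity) (by positivity),
                Real.mul_rpow (by positivity) (by positivity), Real.inv_rpow (by positivity),
                Real.rpow_neg (by positivity), inv_inv, mul_assoc]
    _ ≤ ENNReal.ofReal (5 ^ γ * (1 - t) ^ (-γ)) *
          ∫⁻ θ, ENNReal.ofReal ((1 + ‖θ / (1 - t)‖) ^ (-γ)) := by
        rw [lintegral_const_mul' _ _ ENNReal.ofReal_ne_top]
        gcongr
        exact Measure.restrict_le_self
    _ = _ := by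
        rw [lintegral_comp_div hδ fun x => ENNReal.ofReal ((1 + ‖x‖) ^ (-γ)),
          sub_eq_add_neg 1 γ, Real.rpow_add hδ, Real.rpow_one, ENNReal.ofReal_mul (by positivity),
          ENNReal.ofReal_mul hδ.le]
        ring

variable {α β γ : ℝ} {w : ℝ → ℝ}

lemma lintegral_Ioi_ite_rpow_lt_top {a b : ℝ} (ha : -1 < a) (hb : b < -1) :
    ∫⁻ y in Set.Ioi (0 : ℝ), ENNReal.ofReal (if y < 1 then y ^ a else y ^ b) < ∞ := by
  have hsmall : ∫⁻ y in Set.Ioc (0 : ℝ) 1, ENNReal.ofReal (y ^ a) < ∞ :=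
    (intervalIntegral.intervalIntegrable_rpow' ha).1.lintegral_lt_top
  have hlarge : ∫⁻ y in Set.Ioi (1 : ℝ), ENNReal.ofReal (y ^ b) < ∞ :=
    (integrableOn_Ioi_rpow_of_lt hb one_pos).lintegral_lt_top
  rw [← Set.Ioc_union_Ioi_eq_Ioi zero_le_one]
  refine (lintegral_union_le _ _ _).trans_lt (ENNReal.add_lt_top.2 ⟨?_, ?_⟩)
  · refine (setLIntegral_mono' measurableSet_Ioc fun y hy => ?_).trans_lt hsmall
    split_ifs with h
    · rfl
    · simp [le_antisymm hy.2 (not_lt.1 h)]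
  · refine (setLIntegral_mono' measurableSet_Ioi fun y hy => ?_).trans_lt hlarge
    rw [if_neg (not_lt.2 (Set.mem_Ioi.1 hy).le)]

lemma IsPowerWeight.exists_mul_rpow_le (hw : IsPowerWeight α β w) (hγ : 1 < γ) :
    ∃ K > 0, ∀ ρ ∈ Set.Ico (0 : ℝ) 1, ∀ r ∈ Set.Ico (0 : ℝ) 1,
      w r * (1 - ρ * r) ^ (1 - γ) ≤ K * (w ρ * (1 - ρ) ^ (1 - γ)) *
        if (1 - r) / (1 - ρ) < 1 then ((1 - r) / (1 - ρ)) ^ (α - 1)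
        else ((1 - r) / (1 - ρ)) ^ (β - γ) := by
  obtain ⟨K, hK, hbound⟩ := hw.exists_bounds
  refine ⟨K, hK, fun ρ hρ r hr => ?_⟩
  have hδ : 0 < 1 - ρ := sub_pos.2 hρ.2
  have hε : 0 < 1 - r := sub_pos.2 hr.2
  have hwρ := hw.pos ρ hρ
  have hnonneg : 0 ≤ (1 - ρ * r) ^ (1 - γ) := Real.rpow_nonneg (by nlinarith [hρ.1, hr.1]) _
  split_ifs with h
  · rw [div_lt_one hδ, sub_lt_sub_iff_left] at h
    calc w r * (1 - ρ * r) ^ (1 - γ)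
        ≤ (K * (w ρ * ((1 - r) / (1 - ρ)) ^ (α - 1))) * (1 - ρ) ^ (1 - γ) := by
          gcongr ?_ * ?_
          · exact (hbound ρ r hρ.1 h.le hr.2).1
          · exact Real.rpow_le_rpow_of_nonpos hδ (by nlinarith [hρ.1, hr.2]) (by linarith)
      _ = _ := by ring
  · rw [not_lt, one_le_div hδ, sub_le_sub_iff_left] at h
    have hinv : ((1 - ρ) / (1 - r)) ^ (β - 1) * ((1 - r) / (1 - ρ)) ^ (β - 1) = 1 := by
      rw [← Real.mul_rpow (by positivity) (by positivity), div_mul_div_cancel₀ hε.ne',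
        div_self hδ.ne', Real.one_rpow]
    calc w r * (1 - ρ * r) ^ (1 - γ)
        = (w r * ((1 - ρ) / (1 - r)) ^ (β - 1)) * ((1 - r) / (1 - ρ)) ^ (β - 1) *
            (1 - ρ * r) ^ (1 - γ) := by rw [mul_assoc (w r), hinv, mul_one]
      _ ≤ K * w ρ * ((1 - r) / (1 - ρ)) ^ (β - 1) * (1 - r) ^ (1 - γ) := by
          gcongr ?_ * _ * ?_
          · exact (hbound r ρ hr.1 h hρ.2).2
          · exact Real.rpow_le_rpow_of_nonpos hε (by nlinarith [hr.1, hρ.2]) (by linarith)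
      _ = K * (w ρ * (1 - ρ) ^ (1 - γ)) * ((1 - r) / (1 - ρ)) ^ (β - γ) := by
          rw [show β - γ = (β - 1) + (1 - γ) by ring, Real.rpow_add (by positivity),
            Real.div_rpow hε.le hδ.le (1 - γ)]
          field_simp

lemma IsPowerWeight.exists_lintegral_mul_rpow_le (hw : IsPowerWeight α β w) (hγ : 1 < γ)
    (hβγ : β + 1 < γ) : ∃ C : ℝ≥0∞, C ≠ ∞ ∧ ∀ ρ ∈ Set.Ico (0 : ℝ) 1,
      ∫⁻ r in Set.Ioo 0 1, ENNReal.ofReal (w r * (1 - ρ * r) ^ (1 - γ)) ≤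
        C * ENNReal.ofReal (w ρ * (1 - ρ) ^ (2 - γ)) := by
  obtain ⟨K, hK, hbound⟩ := hw.exists_mul_rpow_le hγ
  set φ : ℝ → ℝ≥0∞ := fun y => ENNReal.ofReal (if y < 1 then y ^ (α - 1) else y ^ (β - γ))
  refine ⟨ENNReal.ofReal K * ∫⁻ y in Set.Ioi 0, φ y, ENNReal.mul_ne_top ENNReal.ofReal_ne_top
    (lintegral_Ioi_ite_rpow_lt_top (by linarith [hw.exponent_pos]) (by linarith)).ne,
    fun ρ hρ => ?_⟩
  have hδ : 0 < 1 - ρ := sub_pos.2 hρ.2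
  have hwρ := hw.pos ρ hρ
  have hchange : ∫⁻ r in Set.Ioo 0 1, φ ((1 - r) / (1 - ρ)) ≤
      ENNReal.ofReal (1 - ρ) * ∫⁻ y in Set.Ioi 0, φ y := by
    calc _ ≤ ∫⁻ r, (Set.Ioi 0).indicator φ ((1 - r) / (1 - ρ)) := by
          rw [← lintegral_indicator measurableSet_Ioo]
          refine lintegral_mono fun r =>
            Set.indicator_apply_le' (fun hr => ?_) fun _ => zero_le
          rw [Set.indicator_of_mem (Set.mem_Ioi.2 (div_pos (sub_pos.2 hr.2) hδ))]
      _ = ∫⁻ x, (Set.Ioi 0).indicator φ (x / (1 - ρ)) :=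
          lintegral_sub_left_eq_self (fun x => (Set.Ioi 0).indicator φ (x / (1 - ρ))) 1
      _ = _ := by rw [lintegral_comp_div hδ, lintegral_indicator measurableSet_Ioi]
  calc _ ≤ ∫⁻ r in Set.Ioo 0 1, ENNReal.ofReal (K * (w ρ * (1 - ρ) ^ (1 - γ))) *
        φ ((1 - r) / (1 - ρ)) := by
        refine setLIntegral_mono' measurableSet_Ioo fun r hr => ?_
        rw [← ENNReal.ofReal_mul (by positivity)]
        exact ENNReal.ofReal_le_ofReal (hbound ρ hρ r ⟨hr.1.le, hr.2⟩)
    _ ≤ ENNReal.ofReal (K * (w ρ * (1 - ρ) ^ (1 - γ))) *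
          (ENNReal.ofReal (1 - ρ) * ∫⁻ y in Set.Ioi 0, φ y) := by
        rw [lintegral_const_mul' _ _ ENNReal.ofReal_ne_top]
        gcongr
    _ = _ := by
        rw [show 2 - γ = (1 - γ) + 1 by ring, Real.rpow_add hδ, Real.rpow_one, ← mul_assoc (w ρ),
          ENNReal.ofReal_mul hK.le, ENNReal.ofReal_mul (p := w ρ * _) (by positivity)]
        ring

lemma setLIntegral_disc_conj_mul (g : ℝ → ℂ → ℝ≥0∞) (a : ℂ) :
    ∫⁻ z in disc, g ‖z‖ (starRingEnd ℂ a * z) = ∫⁻ z in disc, g ‖z‖ (‖a‖ * z) := by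
  set u := rotation (Circle.exp a.arg)
  have hconj : ∀ z, starRingEnd ℂ a * u z = ‖a‖ * z := fun z => by
    rw [rotation_apply, Circle.coe_exp]
    nth_rewrite 1 [← Complex.norm_mul_exp_arg_mul_I a]
    rw [map_mul, Complex.conj_ofReal, ← Complex.exp_conj, map_mul, Complex.conj_I,
      Complex.conj_ofReal, mul_assoc, ← mul_assoc (Complex.exp _), ← Complex.exp_add]
    simp
  have hdisc : u ⁻¹' disc = disc := by ext z; simp
  rw [← u.measurePreserving.setLIntegral_comp_preimage_emb u.toHomeomorph.measurableEmbedding,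
    hdisc]
  simp only [hconj, u.norm_map]

lemma IsPowerWeight.exists_setLIntegral_disc_mul_rpow_le (hw : IsPowerWeight α β w) (hγ : 1 < γ)
    (hβγ : β + 1 < γ) : ∃ C : ℝ≥0∞, C ≠ ∞ ∧ ∀ ρ ∈ Set.Ico (0 : ℝ) 1,
      ∫⁻ z in disc, ENNReal.ofReal (w ‖z‖) * ENNReal.ofReal (‖1 - ρ * z‖ ^ (-γ)) ≤
        C * ENNReal.ofReal (w ρ * (1 - ρ) ^ (2 - γ)) := by
  obtain ⟨C, hC, hcircle⟩ := exists_lintegral_norm_one_sub_circleMap_le hγ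
  obtain ⟨D, hD, hradial⟩ := hw.exists_lintegral_mul_rpow_le hγ hβγ
  refine ⟨C * D, ENNReal.mul_ne_top hC hD, fun ρ hρ => ?_⟩
  rw [setLIntegral_ball_eq_polar, Measure.volume_eq_prod, ← Measure.prod_restrict]
  calc _ ≤ ∫⁻ r in Set.Ioo 0 1, C * ENNReal.ofReal (w r * (1 - ρ * r) ^ (1 - γ)) := by
        refine (lintegral_prod_le _).trans (setLIntegral_mono' measurableSet_Ioo fun r hr => ?_)
        have hρr : ρ * r ∈ Set.Ico (0 : ℝ) 1 :=
          ⟨mul_nonneg hρ.1 hr.1.le, mul_lt_one_of_nonneg_of_lt_one_left hρ.1 hρ.2 hr.2.le⟩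
        have hscale : ∀ θ, ρ * circleMap 0 r θ = circleMap 0 (ρ * r) θ := fun θ => by
          simp only [circleMap_zero, Complex.ofReal_mul, mul_assoc]
        simp only [norm_circleMap_zero, abs_of_pos hr.1, hscale]
        calc _ ≤ ∫⁻ θ in Set.Ioo (-Real.pi) Real.pi, ENNReal.ofReal (w r) *
              ENNReal.ofReal (‖1 - circleMap 0 (ρ * r) θ‖ ^ (-γ)) := by
              refine lintegral_mono fun θ => ?_
              exact mul_le_of_le_one_left' (ENNReal.ofReal_le_one.2 hr.2.le)
          _ ≤ ENNReal.ofReal (w r) * (C * ENNReal.ofReal ((1 - ρ * r) ^ (1 - γ))) := by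
              rw [lintegral_const_mul' _ _ ENNReal.ofReal_ne_top]
              gcongr
              exact hcircle _ hρr
          _ = _ := by
              rw [ENNReal.ofReal_mul (hw.pos r ⟨hr.1.le, hr.2⟩).le]
              ring
    _ ≤ _ := by
        rw [lintegral_const_mul' _ _ hC, mul_assoc]
        gcongr
        exact hradial ρ hρ

/-- The distance of a point of the disc to the unit circle. -/
def depth (a : ℂ) : ℝ≥0∞ := ENNReal.ofReal (1 - ‖a‖)

/-- The weighted area of the Whitney ball around `a`, up to constants. -/
def cellArea (w : ℝ → ℝ) (a : ℂ) : ℝ≥0∞ := ENNReal.ofReal (w ‖a‖) * depth a ^ 2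

/-- The Szegő kernel of the point `a`, normalized so that its absolute value is at most one and is
bounded below near `a`. Its powers are the test functions in the Bergman spaces. -/
def szegoKernel (a z : ℂ) : ℂ := (1 - ‖a‖) / (1 - starRingEnd ℂ a * z)

theorem IsPowerWeight.exists_lintegral_szegoKernel_rpow_le (hw : IsPowerWeight α β w) (hγ : 1 < γ)
    (hβγ : β + 1 < γ) : ∃ C : ℝ≥0∞, C ≠ ∞ ∧ ∀ a ∈ disc,
      ∫⁻ z, ‖szegoKernel a z‖ₑ ^ γ ∂weightedArea w ≤ C * cellArea w a := by
  obtain ⟨C, hC, hbound⟩ := hw.exists_setLIntegral_disc_mul_rpow_le hγ hβγ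
  refine ⟨ENNReal.ofReal Real.pi⁻¹ * C, ENNReal.mul_ne_top ENNReal.ofReal_ne_top hC,
    fun a ha => ?_⟩
  have ha1 : ‖a‖ ∈ Set.Ico (0 : ℝ) 1 := ⟨norm_nonneg a, mem_ball_zero_iff.1 ha⟩
  have hδ : 0 < 1 - ‖a‖ := sub_pos.2 ha1.2
  have hkernel : ∀ z, ‖szegoKernel a z‖ₑ ^ γ =
      ENNReal.ofReal ((1 - ‖a‖) ^ γ) * ENNReal.ofReal (‖1 - starRingEnd ℂ a * z‖ ^ (-γ)) :=
    fun z => by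
      rw [← ofReal_norm, ENNReal.ofReal_rpow_of_nonneg (norm_nonneg _) (by linarith),
        szegoKernel, norm_div, ← Complex.ofReal_one, ← Complex.ofReal_sub,
        Complex.norm_of_nonneg hδ.le, Real.div_rpow hδ.le (norm_nonneg _), div_eq_mul_inv,
        ← Real.rpow_neg (norm_nonneg _), ENNReal.ofReal_mul (by positivity)]
  rw [lintegral_weightedArea hw.aemeasurable, mul_assoc]
  simp only [hkernel, mul_left_comm (ENNReal.ofReal (w _))]
  rw [lintegral_const_mul' _ _ ENNReal.ofReal_ne_top,
    setLIntegral_disc_conj_mul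
      (fun r ζ => ENNReal.ofReal (w r) * ENNReal.ofReal (‖1 - ζ‖ ^ (-γ)))]
  refine mul_le_mul_right ?_ _
  calc _ ≤ ENNReal.ofReal ((1 - ‖a‖) ^ γ) *
        (C * ENNReal.ofReal (w ‖a‖ * (1 - ‖a‖) ^ (2 - γ))) := by
        gcongr
        exact hbound _ ha1
    _ = C * cellArea w a := by
        rw [mul_left_comm, ← ENNReal.ofReal_mul (by positivity), mul_left_comm,
          ← Real.rpow_add hδ, add_sub_cancel, Real.rpow_two, cellArea, depth,
          ENNReal.ofReal_mul (hw.pos _ ha1).le, ENNReal.ofReal_pow hδ.le]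

end Kernel

section Cells

variable {α β p : ℝ} {w : ℝ → ℝ} {a z : ℂ}

lemma depth_ne_zero (ha : a ∈ disc) : depth a ≠ 0 :=
  ENNReal.ofReal_ne_zero_iff.2 (sub_pos.2 (mem_ball_zero_iff.1 ha))

lemma depth_ne_top : depth a ≠ ∞ := ENNReal.ofReal_ne_top

lemma depth_rpow_add (ha : a ∈ disc) (x y : ℝ) : depth a ^ (x + y) = depth a ^ x * depth a ^ y :=
  ENNReal.rpow_add _ _ (depth_ne_zero ha) depth_ne_top

lemma measurable_depth : Measurable depth := by
  unfold depth
  fun_prop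

lemma IsPowerWeight.cellArea_ne_zero (hw : IsPowerWeight α β w) (ha : a ∈ disc) :
    cellArea w a ≠ 0 :=
  mul_ne_zero (ENNReal.ofReal_ne_zero_iff.2 (hw.pos _ ⟨norm_nonneg a, mem_ball_zero_iff.1 ha⟩))
    (pow_ne_zero _ (depth_ne_zero ha))

lemma cellArea_ne_top : cellArea w a ≠ ∞ :=
  ENNReal.mul_ne_top ENNReal.ofReal_ne_top (ENNReal.pow_ne_top depth_ne_top)

lemma ofReal_one_sub_norm_rpow (ha : a ∈ disc) (x : ℝ) :
    ENNReal.ofReal ((1 - ‖a‖) ^ x) = depth a ^ x :=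
  (ENNReal.ofReal_rpow_of_pos (sub_pos.2 (mem_ball_zero_iff.1 ha))).symm

lemma cellArea_mul_one_sub_rpow (ha : a ∈ disc) (x : ℝ) :
    cellArea (fun r => w r * (1 - r) ^ x) a = cellArea w a * depth a ^ x := by
  rw [cellArea, cellArea, ENNReal.ofReal_mul' (Real.rpow_nonneg
    (sub_pos.2 (mem_ball_zero_iff.1 ha)).le _), ofReal_one_sub_norm_rpow ha, mul_right_comm]

lemma cellArea_one_sub_rpow (ha : a ∈ disc) (x : ℝ) :
    cellArea (fun r => (1 - r) ^ x) a = depth a ^ (x + 2) := by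
  rw [cellArea, ofReal_one_sub_norm_rpow ha, depth_rpow_add ha, ENNReal.rpow_two]

lemma lintegral_weightedArea_mul_one_sub_rpow (hw : AEMeasurable w (volume.restrict (Set.Ico 0 1)))
    (x : ℝ) (g : ℂ → ℝ≥0∞) :
    ∫⁻ z, g z ∂weightedArea (fun r => w r * (1 - r) ^ x) =
      ∫⁻ z, g z * depth z ^ x ∂weightedArea w := by
  have hmul : AEMeasurable (fun r => w r * (1 - r) ^ x) (volume.restrict (Set.Ico 0 1)) :=
    hw.mul (by fun_prop)
  rw [lintegral_weightedArea hmul, lintegral_weightedArea hw]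
  congr 1
  refine setLIntegral_congr_fun measurableSet_ball fun z hz => ?_
  rw [ENNReal.ofReal_mul' (Real.rpow_nonneg (sub_pos.2 (mem_ball_zero_iff.1 hz)).le _),
    ofReal_one_sub_norm_rpow hz]
  ring

lemma IsPowerWeight.exists_le_mul_of_mem_whitneyBall (hw : IsPowerWeight α β w) :
    ∃ C > 0, ∀ a ∈ disc, ∀ ζ ∈ whitneyBall a, w ‖a‖ ≤ C * w ‖ζ‖ := by
  obtain ⟨C, hC, hcomp⟩ := hw.exists_le_mul_of_comparable
  refine ⟨C, hC, fun a ha ζ hζ => ?_⟩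
  have hdist := abs_lt.1 (abs_norm_sub_norm_lt_of_mem_whitneyBall hζ)
  exact hcomp _ ⟨norm_nonneg a, mem_ball_zero_iff.1 ha⟩ _
    ⟨norm_nonneg ζ, mem_ball_zero_iff.1 (whitneyBall_subset_disc a hζ)⟩
    (by linarith) (by linarith)

theorem IsPowerWeight.exists_cellArea_mul_enorm_rpow_le (hw : IsPowerWeight α β w) (hp : 0 < p) :
    ∃ C : ℝ≥0∞, C ≠ ∞ ∧ ∀ f : ℂ → ℂ, DifferentiableOn ℂ f disc → ∀ a ∈ disc, ∀ z ∈ whitneyCell a,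
      cellArea w a * ‖f z‖ₑ ^ p ≤ C * ∫⁻ ζ in whitneyBall a, ‖f ζ‖ₑ ^ p ∂weightedArea w := by
  obtain ⟨C, hC, hcomp⟩ := hw.exists_le_mul_of_mem_whitneyBall
  refine ⟨ENNReal.ofReal (16 * C), ENNReal.ofReal_ne_top, fun f hf a ha z hz => ?_⟩
  have hδ : 0 < 1 - ‖a‖ := sub_pos.2 (mem_ball_zero_iff.1 ha)
  have hwa := (hw.pos _ ⟨norm_nonneg a, mem_ball_zero_iff.1 ha⟩).le
  have hsub := ball_subset_whitneyBall hz
  have := Real.pi_pos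
  have hconst : cellArea w a = ENNReal.ofReal (16 * Real.pi⁻¹) * (ENNReal.ofReal (w ‖a‖) *
      ENNReal.ofReal (Real.pi * ((1 - ‖a‖) / 4) ^ 2)) := by
    rw [cellArea, depth, ← ENNReal.ofReal_pow hδ.le, ← ENNReal.ofReal_mul hwa,
      ← ENNReal.ofReal_mul hwa, ← ENNReal.ofReal_mul (by positivity)]
    congr 1
    field_simp
    norm_num
  calc cellArea w a * ‖f z‖ₑ ^ p
      ≤ ENNReal.ofReal (16 * Real.pi⁻¹) * (ENNReal.ofReal (w ‖a‖) *
          ∫⁻ ζ in Metric.ball z ((1 - ‖a‖) / 4), ‖f ζ‖ₑ ^ p) := by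
        rw [hconst, mul_assoc, mul_assoc]
        gcongr
        exact ofReal_mul_enorm_rpow_le_setLIntegral_ball (by positivity)
          (hf.mono (hsub.trans (whitneyBall_subset_disc a))) hp
    _ ≤ ENNReal.ofReal (16 * Real.pi⁻¹) *
          ∫⁻ ζ in whitneyBall a, ENNReal.ofReal (w ‖a‖) * ‖f ζ‖ₑ ^ p := by
        rw [← lintegral_const_mul' _ _ ENNReal.ofReal_ne_top]
        gcongr
    _ ≤ ENNReal.ofReal (16 * Real.pi⁻¹) * (ENNReal.ofReal C *
          ∫⁻ ζ in whitneyBall a, ENNReal.ofReal (w ‖ζ‖) * ‖f ζ‖ₑ ^ p) := by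
        rw [← lintegral_const_mul' (ENNReal.ofReal C) _ ENNReal.ofReal_ne_top]
        refine mul_le_mul_right (setLIntegral_mono' measurableSet_ball fun ζ hζ => ?_) _
        rw [← mul_assoc, ← ENNReal.ofReal_mul hC.le]
        gcongr
        exact hcomp a ha ζ hζ
    _ = _ := by
        rw [setLIntegral_weightedArea hw.aemeasurable (s := whitneyBall a) _ measurableSet_ball
          (whitneyBall_subset_disc a),
          ENNReal.ofReal_mul (by norm_num), ENNReal.ofReal_mul (by norm_num)]
        ring

lemma IsPowerWeight.exists_le_cellArea (hw : IsPowerWeight α β w) {r : ℝ} (hr : r < 1) :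
    ∃ c : ℝ≥0∞, c ≠ 0 ∧ ∀ z ∈ Metric.closedBall (0 : ℂ) r, c ≤ cellArea w z := by
  obtain ⟨K, hK, hbounds⟩ := hw.exists_bounds
  have hw0 := hw.pos 0 (by simp)
  have hδ : 0 < 1 - r := sub_pos.2 hr
  refine ⟨ENNReal.ofReal (w 0 * (1 - r) ^ |β - 1| / K) * ENNReal.ofReal (1 - r) ^ 2,
    mul_ne_zero ?_ ?_, fun z hz => ?_⟩
  · exact ENNReal.ofReal_ne_zero_iff.2 (by positivity)
  · exact pow_ne_zero _ (ENNReal.ofReal_ne_zero_iff.2 hδ)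
  have hzr : ‖z‖ ≤ r := mem_closedBall_zero_iff.1 hz
  have hz1 : 0 < 1 - ‖z‖ := by linarith
  have hlower : w 0 * (1 - r) ^ |β - 1| / K ≤ w ‖z‖ := by
    rw [div_le_iff₀' hK]
    calc w 0 * (1 - r) ^ |β - 1| ≤ w 0 * (1 - ‖z‖) ^ |β - 1| := by gcongr
      _ ≤ w 0 * (1 - ‖z‖) ^ (β - 1) := by
        exact mul_le_mul_of_nonneg_left (Real.rpow_le_rpow_of_exponent_ge hz1
          (by linarith [norm_nonneg z]) (le_abs_self _)) hw0.le
      _ ≤ K * w ‖z‖ := by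
        simpa using (hbounds 0 ‖z‖ le_rfl (norm_nonneg z) (by linarith)).2
  rw [cellArea, depth]
  gcongr

theorem IsPowerWeight.exists_enorm_rpow_le_lintegral (hw : IsPowerWeight α β w) (hp : 0 < p)
    {r : ℝ} (hr : r < 1) : ∃ C : ℝ≥0∞, C ≠ ∞ ∧ ∀ f : ℂ → ℂ, DifferentiableOn ℂ f disc →
      ∀ z ∈ Metric.closedBall (0 : ℂ) r, ‖f z‖ₑ ^ p ≤ C * ∫⁻ ζ, ‖f ζ‖ₑ ^ p ∂weightedArea w := by
  obtain ⟨C, hC, hlocal⟩ := hw.exists_cellArea_mul_enorm_rpow_le hp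
  obtain ⟨c, hc, hcell⟩ := hw.exists_le_cellArea hr
  refine ⟨C / c, ENNReal.div_ne_top hC hc, fun f hf z hz => ?_⟩
  have hzdisc : z ∈ disc := Metric.closedBall_subset_ball hr hz
  have hc' : c ≠ ∞ := ne_top_of_le_ne_top cellArea_ne_top (hcell z hz)
  rw [← ENNReal.mul_div_right_comm, ENNReal.le_div_iff_mul_le (.inl hc) (.inl hc'), mul_comm]
  calc c * ‖f z‖ₑ ^ p ≤ cellArea w z * ‖f z‖ₑ ^ p := by gcongr; exact hcell z hz
    _ ≤ C * ∫⁻ ζ in whitneyBall z, ‖f ζ‖ₑ ^ p ∂weightedArea w := hlocal f hf z hzdisc z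
        (mem_whitneyCell_self hzdisc)
    _ ≤ C * ∫⁻ ζ, ‖f ζ‖ₑ ^ p ∂weightedArea w := by gcongr; exact Measure.restrict_le_self

end Cells

section SzegoKernel

variable {a z : ℂ}

lemma one_sub_norm_le_norm_one_sub_conj_mul (hz : z ∈ disc) :
    1 - ‖a‖ ≤ ‖1 - starRingEnd ℂ a * z‖ := by
  have hlower := norm_sub_norm_le (1 : ℂ) (starRingEnd ℂ a * z)
  rw [norm_mul, Complex.norm_conj, norm_one] at hlower
  nlinarith [norm_nonneg a, mem_ball_zero_iff.1 hz]

lemma one_sub_conj_mul_ne_zero (ha : a ∈ disc) (hz : z ∈ disc) :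
    1 - starRingEnd ℂ a * z ≠ 0 :=
  norm_pos_iff.1 ((sub_pos.2 (mem_ball_zero_iff.1 ha)).trans_le
    (one_sub_norm_le_norm_one_sub_conj_mul hz))

lemma differentiableOn_szegoKernel (ha : a ∈ disc) : DifferentiableOn ℂ (szegoKernel a) disc :=
  DifferentiableOn.div (by fun_prop) (by fun_prop) fun _ => one_sub_conj_mul_ne_zero ha

lemma measurable_szegoKernel (a : ℂ) : Measurable (szegoKernel a) := by
  unfold szegoKernel
  fun_prop

lemma enorm_szegoKernel (ha : a ∈ disc) (hz : z ∈ disc) :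
    ‖szegoKernel a z‖ₑ = depth a / ‖1 - starRingEnd ℂ a * z‖ₑ := by
  have hδ : 0 ≤ 1 - ‖a‖ := (sub_pos.2 (mem_ball_zero_iff.1 ha)).le
  have hnum : ‖(1 - ‖a‖ : ℂ)‖ = 1 - ‖a‖ := by
    rw [← Complex.ofReal_one, ← Complex.ofReal_sub, Complex.norm_of_nonneg hδ]
  rw [szegoKernel, ← ofReal_norm, ← ofReal_norm, norm_div, hnum, depth,
    ENNReal.ofReal_div_of_pos (norm_pos_iff.2 (one_sub_conj_mul_ne_zero ha hz))]

lemma enorm_szegoKernel_eq_mul_div (ha : a ∈ disc) (hz : z ∈ disc) :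
    ‖szegoKernel a z‖ₑ = ‖szegoKernel z a‖ₑ * (depth a / depth z) := by
  have hconj : ‖1 - starRingEnd ℂ a * z‖ₑ = ‖1 - starRingEnd ℂ z * a‖ₑ := by
    rw [← RCLike.enorm_conj]
    simp [mul_comm]
  rw [enorm_szegoKernel ha hz, enorm_szegoKernel hz ha, hconj]
  calc depth a / ‖1 - starRingEnd ℂ z * a‖ₑ
      = depth a * (depth z * (depth z)⁻¹) / ‖1 - starRingEnd ℂ z * a‖ₑ := by
        rw [ENNReal.mul_inv_cancel (depth_ne_zero hz) depth_ne_top, mul_one]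
    _ = _ := by simp only [div_eq_mul_inv]; ring

lemma one_third_le_enorm_szegoKernel (ha : a ∈ disc) (hz : z ∈ whitneyCell a) :
    3⁻¹ ≤ ‖szegoKernel a z‖ₑ := by
  have ha1 : ‖a‖ < 1 := mem_ball_zero_iff.1 ha
  have hzdisc := whitneyBall_subset_disc a (whitneyCell_subset_whitneyBall ha hz)
  have hza : ‖z - a‖ ≤ (1 - ‖a‖) / 4 := mem_closedBall_iff_norm.1 hz
  have hsplit : 1 - starRingEnd ℂ a * z = ((1 - ‖a‖ ^ 2 : ℝ) : ℂ) - starRingEnd ℂ a * (z - a) := by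
    rw [mul_sub, Complex.conj_mul', Complex.ofReal_sub]
    push_cast
    ring
  have hle : ‖1 - starRingEnd ℂ a * z‖ ≤ 3 * (1 - ‖a‖) := by
    rw [hsplit]
    refine (norm_sub_le _ _).trans ?_
    rw [norm_mul, Complex.norm_conj, Complex.norm_of_nonneg (by nlinarith [norm_nonneg a])]
    nlinarith [norm_nonneg a, norm_nonneg (z - a)]
  rw [enorm_szegoKernel ha hzdisc, depth, ← ofReal_norm,
    ← ENNReal.ofReal_div_of_pos (norm_pos_iff.2 (one_sub_conj_mul_ne_zero ha hzdisc)),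
    ← ENNReal.ofReal_ofNat 3, ← ENNReal.ofReal_inv_of_pos three_pos]
  refine ENNReal.ofReal_le_ofReal ?_
  rw [le_div_iff₀ (norm_pos_iff.2 (one_sub_conj_mul_ne_zero ha hzdisc))]
  linarith

end SzegoKernel

section Synthesis

lemma rpow_sum_le_sum_rpow {ι : Type*} {p : ℝ} (hp : 0 < p) (hp1 : p ≤ 1) (s : Finset ι)
    (u : ι → ℝ≥0∞) : (∑ i ∈ s, u i) ^ p ≤ ∑ i ∈ s, u i ^ p :=
  Finset.le_sum_of_subadditive (· ^ p) (ENNReal.zero_rpow_of_pos hp).le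
    (fun x y => ENNReal.rpow_add_le_add_rpow x y hp.le hp1) s u

lemma rpow_sum_mul_le {ι : Type*} {p : ℝ} (hp : 1 ≤ p) (s : Finset ι) (w u : ι → ℝ≥0∞) :
    (∑ i ∈ s, w i * u i) ^ p ≤ (∑ i ∈ s, w i) ^ (p - 1) * ∑ i ∈ s, w i * u i ^ p := by
  have hp0 : 0 < p := by linarith
  refine (ENNReal.rpow_le_rpow (ENNReal.inner_le_weight_mul_Lp_of_nonneg s hp w u) hp0.le).trans ?_
  rw [ENNReal.mul_rpow_of_nonneg _ _ hp0.le, ENNReal.rpow_inv_rpow hp0.ne', ← ENNReal.rpow_mul,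
    sub_mul, one_mul, inv_mul_cancel₀ hp0.ne']

variable {Λ : Set ℂ} {N : ℕ} {α β p : ℝ} {w : ℝ → ℝ}

theorem IsWhitneyLattice.exists_sum_szegoKernel_rpow_le (hΛ : IsWhitneyLattice Λ N) {γ η : ℝ}
    (hη : 0 < η) (hγ : 1 + η < γ) :
    ∃ C : ℝ≥0∞, C ≠ ∞ ∧ ∀ z ∈ disc, ∀ s : Finset ℂ, (s : Set ℂ) ⊆ Λ →
      ∑ a ∈ s, ‖szegoKernel a z‖ₑ ^ γ * depth a ^ (-η) ≤ C * depth z ^ (-η) := by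
  have hv := isPowerWeight_one_sub_rpow (x := γ - η - 2) (by linarith)
  obtain ⟨C, hC, hlocal⟩ := hv.exists_cellArea_mul_enorm_rpow_le (p := γ) (by linarith)
  obtain ⟨D, hD, hint⟩ := hv.exists_lintegral_szegoKernel_rpow_le (γ := γ) (by linarith)
    (by linarith)
  refine ⟨C * (N * D), by finiteness, fun z hz s hs => ?_⟩
  have hterm : ∀ a ∈ s, ‖szegoKernel a z‖ₑ ^ γ * depth a ^ (-η) ≤ depth z ^ (-γ) *
      (C * ∫⁻ ζ in whitneyBall a, ‖szegoKernel z ζ‖ₑ ^ γ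
        ∂weightedArea fun r => (1 - r) ^ (γ - η - 2)) := fun a has => by
    have ha := hΛ.subset_disc (hs has)
    have h := hlocal _ (differentiableOn_szegoKernel hz) a ha a (mem_whitneyCell_self ha)
    rw [cellArea_one_sub_rpow ha, sub_add_cancel, sub_eq_add_neg, depth_rpow_add ha] at h
    refine le_trans (le_of_eq ?_) (mul_le_mul_right h _)
    rw [enorm_szegoKernel_eq_mul_div ha hz, ENNReal.mul_rpow_of_nonneg _ _ (by linarith),
      ENNReal.div_rpow_of_nonneg _ _ (by linarith), div_eq_mul_inv, ENNReal.rpow_neg _ γ]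
    ring
  calc ∑ a ∈ s, ‖szegoKernel a z‖ₑ ^ γ * depth a ^ (-η)
      ≤ depth z ^ (-γ) * (C * ∑ a ∈ s, ∫⁻ ζ in whitneyBall a, ‖szegoKernel z ζ‖ₑ ^ γ
          ∂weightedArea fun r => (1 - r) ^ (γ - η - 2)) := by
        rw [Finset.mul_sum, Finset.mul_sum]
        exact Finset.sum_le_sum hterm
    _ ≤ depth z ^ (-γ) * (C * (N * (D * cellArea (fun r => (1 - r) ^ (γ - η - 2)) z))) := by
        gcongr
        refine (hΛ.sum_setLIntegral_le _ _ hs).trans (mul_le_mul_right ?_ _)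
        exact (lintegral_mono' Measure.restrict_le_self le_rfl).trans (hint z hz)
    _ = C * (N * D) * (depth z ^ (-γ) * depth z ^ (γ - η)) := by
        rw [cellArea_one_sub_rpow hz, sub_add_cancel]
        ring
    _ = C * (N * D) * depth z ^ (-η) := by
        rw [← depth_rpow_add hz]
        congr 2
        ring

lemma IsWhitneyLattice.exists_rpow_sum_le_of_one_lt (hΛ : IsWhitneyLattice Λ N) (hp : 1 < p)
    {γ η : ℝ} (hη : 0 < η) (hγ : 1 + η < γ) :
    ∃ C : ℝ≥0∞, C ≠ ∞ ∧ ∀ z ∈ disc, ∀ s : Finset ℂ, (s : Set ℂ) ⊆ Λ → ∀ u : ℂ → ℝ≥0∞,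
      (∑ a ∈ s, u a * ‖szegoKernel a z‖ₑ ^ γ) ^ p ≤ C * ∑ a ∈ s, u a ^ p *
        depth a ^ (η * (p - 1)) * (‖szegoKernel a z‖ₑ ^ γ * depth z ^ (-(η * (p - 1)))) := by
  have hp' : 0 ≤ p - 1 := by linarith
  obtain ⟨C, hC, hschur⟩ := hΛ.exists_sum_szegoKernel_rpow_le hη hγ
  refine ⟨C ^ (p - 1), ENNReal.rpow_ne_top_of_nonneg hp' hC, fun z hz s hs u => ?_⟩
  calc (∑ a ∈ s, u a * ‖szegoKernel a z‖ₑ ^ γ) ^ p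
      = (∑ a ∈ s, ‖szegoKernel a z‖ₑ ^ γ * depth a ^ (-η) * (u a * depth a ^ η)) ^ p := by
        congr 1
        refine Finset.sum_congr rfl fun a ha => ?_
        rw [mul_mul_mul_comm, ← depth_rpow_add (hΛ.subset_disc (hs ha)), mul_right_comm,
          neg_add_cancel, ENNReal.rpow_zero, mul_one, mul_comm]
    _ ≤ (∑ a ∈ s, ‖szegoKernel a z‖ₑ ^ γ * depth a ^ (-η)) ^ (p - 1) *
          ∑ a ∈ s, ‖szegoKernel a z‖ₑ ^ γ * depth a ^ (-η) * (u a * depth a ^ η) ^ p :=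
        rpow_sum_mul_le hp.le s _ _
    _ ≤ (C * depth z ^ (-η)) ^ (p - 1) *
          ∑ a ∈ s, u a ^ p * depth a ^ (η * (p - 1)) * ‖szegoKernel a z‖ₑ ^ γ := by
        refine mul_le_mul' (ENNReal.rpow_le_rpow (hschur z hz s hs) hp')
          (Finset.sum_le_sum fun a ha => le_of_eq ?_)
        rw [ENNReal.mul_rpow_of_nonneg _ _ (by linarith), ← ENNReal.rpow_mul,
          show η * (p - 1) = -η + η * p by ring, depth_rpow_add (hΛ.subset_disc (hs ha))]
        ring
    _ = _ := by
        rw [ENNReal.mul_rpow_of_nonneg _ _ hp', ← ENNReal.rpow_mul, neg_mul, mul_assoc,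
          Finset.mul_sum]
        exact congrArg _ (Finset.sum_congr rfl fun a _ => by ring)

theorem IsWhitneyLattice.exists_rpow_sum_le (hΛ : IsWhitneyLattice Λ N) (hp : 0 < p) (hα : 0 < α) :
    ∃ τ < α, ∀ᶠ M : ℕ in atTop, ∃ C : ℝ≥0∞, C ≠ ∞ ∧ ∀ z ∈ disc, ∀ s : Finset ℂ, (s : Set ℂ) ⊆ Λ →
      ∀ u : ℂ → ℝ≥0∞, (∑ a ∈ s, u a * ‖szegoKernel a z‖ₑ ^ M) ^ p ≤ C * ∑ a ∈ s, u a ^ p *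
        depth a ^ τ * (‖szegoKernel a z‖ₑ ^ (M * min p 1) * depth z ^ (-τ)) := by
  rcases le_or_gt p 1 with hp1 | hp1
  · refine ⟨0, hα, Eventually.of_forall fun M => ⟨1, ENNReal.one_ne_top, fun z _ s _ u => ?_⟩⟩
    simp only [min_eq_left hp1, neg_zero, ENNReal.rpow_zero, mul_one, one_mul]
    refine (rpow_sum_le_sum_rpow hp hp1 s _).trans_eq (Finset.sum_congr rfl fun a _ => ?_)
    rw [ENNReal.mul_rpow_of_nonneg _ _ hp.le, ← ENNReal.rpow_natCast, ENNReal.rpow_mul]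
  · refine ⟨α / p * (p - 1), ?_, ?_⟩
    · rw [div_mul_eq_mul_div, div_lt_iff₀ hp]
      nlinarith
    filter_upwards [tendsto_natCast_atTop_atTop.eventually_gt_atTop (1 + α / p)] with M hM
    simpa only [min_eq_right hp1.le, mul_one, ENNReal.rpow_natCast]
      using hΛ.exists_rpow_sum_le_of_one_lt hp1 (div_pos hα hp) hM

lemma ae_mem_disc : ∀ᵐ z ∂weightedArea w, z ∈ disc := by
  rw [← weightedArea_restrict_disc]
  exact ae_restrict_mem measurableSet_ball

/-- The linear combination `∑ c_a K_a ^ M` of powers of the normalized Szegő kernels at finitely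
many points. These are the test functions of the necessity proof. -/
def szegoSum (M : ℕ) (s : Finset ℂ) (c : ℂ → ℂ) (z : ℂ) : ℂ := ∑ a ∈ s, c a * szegoKernel a z ^ M

lemma differentiableOn_szegoSum {M : ℕ} {s : Finset ℂ} (hs : (s : Set ℂ) ⊆ disc) (c : ℂ → ℂ) :
    DifferentiableOn ℂ (szegoSum M s c) disc :=
  DifferentiableOn.fun_sum fun _ ha => ((differentiableOn_szegoKernel (hs ha)).pow M).const_mul _

theorem IsPowerWeight.exists_lintegral_szegoSum_le (hw : IsPowerWeight α β w)
    (hΛ : IsWhitneyLattice Λ N) (hp : 0 < p) :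
    ∀ᶠ M : ℕ in atTop, ∃ C : ℝ≥0∞, C ≠ ∞ ∧ ∀ s : Finset ℂ, (s : Set ℂ) ⊆ Λ → ∀ c : ℂ → ℂ,
      ∫⁻ z, ‖szegoSum M s c z‖ₑ ^ p ∂weightedArea w ≤
        C * ∑ a ∈ s, ‖c a‖ₑ ^ p * cellArea w a := by
  obtain ⟨τ, hτ, hpointwise⟩ := hΛ.exists_rpow_sum_le hp hw.exponent_pos
  have hlarge : ∀ᶠ M : ℕ in atTop, max 1 (β + -τ + 1) < M * min p 1 :=
    ((tendsto_natCast_atTop_atTop (R := ℝ)).atTop_mul_const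
      (lt_min hp one_pos)).eventually_gt_atTop _
  filter_upwards [hpointwise, hlarge] with M ⟨C, hC, hpt⟩ hM
  obtain ⟨D, hD, hint⟩ := (hw.mul_one_sub_rpow (x := -τ)
    (by linarith)).exists_lintegral_szegoKernel_rpow_le ((le_max_left _ _).trans_lt hM)
    ((le_max_right _ _).trans_lt hM)
  refine ⟨C * D, by finiteness, fun s hs c => ?_⟩
  calc ∫⁻ z, ‖szegoSum M s c z‖ₑ ^ p ∂weightedArea w
      ≤ ∫⁻ z, C * ∑ a ∈ s, ‖c a‖ₑ ^ p * depth a ^ τ *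
          (‖szegoKernel a z‖ₑ ^ (M * min p 1) * depth z ^ (-τ)) ∂weightedArea w := by
        refine lintegral_mono_ae (ae_mem_disc.mono fun z hz => (ENNReal.rpow_le_rpow ?_ hp.le).trans
          (hpt z hz s hs fun a => ‖c a‖ₑ))
        refine (enorm_sum_le _ _).trans (Finset.sum_le_sum fun a _ => ?_)
        rw [enorm_mul, enorm_pow]
    _ = C * ∑ a ∈ s, ‖c a‖ₑ ^ p * depth a ^ τ *
          ∫⁻ z, ‖szegoKernel a z‖ₑ ^ (M * min p 1) ∂weightedArea fun r => w r * (1 - r) ^ (-τ) := by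
        have hmeas : ∀ a, Measurable fun z =>
            ‖szegoKernel a z‖ₑ ^ (M * min p 1) * depth z ^ (-τ) := fun a =>
          ((measurable_szegoKernel a).enorm.pow_const _).mul (measurable_depth.pow_const _)
        rw [lintegral_const_mul' _ _ hC, lintegral_finsetSum _ fun a _ => (hmeas a).const_mul _]
        simp only [lintegral_const_mul _ (hmeas _),
          lintegral_weightedArea_mul_one_sub_rpow hw.aemeasurable]
    _ ≤ C * ∑ a ∈ s, ‖c a‖ₑ ^ p * depth a ^ τ * (D * (cellArea w a * depth a ^ (-τ))) := by
        gcongr with a ha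
        rw [← cellArea_mul_one_sub_rpow (hΛ.subset_disc (hs ha))]
        exact hint a (hΛ.subset_disc (hs ha))
    _ = C * D * ∑ a ∈ s, ‖c a‖ₑ ^ p * cellArea w a := by
        rw [mul_assoc C, Finset.mul_sum _ _ D]
        refine congrArg _ (Finset.sum_congr rfl fun a ha => ?_)
        have hcancel : depth a ^ τ * depth a ^ (-τ) = 1 := by
          rw [← depth_rpow_add (hΛ.subset_disc (hs ha)), add_neg_cancel, ENNReal.rpow_zero]
        calc _ = D * (‖c a‖ₑ ^ p * cellArea w a) * (depth a ^ τ * depth a ^ (-τ)) := by ring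
          _ = _ := by rw [hcancel, mul_one]

theorem IsPowerWeight.exists_enorm_szegoSum_rpow_le (hw : IsPowerWeight α β w)
    (hΛ : IsWhitneyLattice Λ N) (hp : 0 < p) :
    ∀ᶠ M : ℕ in atTop, ∀ r < 1, ∃ C : ℝ≥0∞, C ≠ ∞ ∧ ∀ s : Finset ℂ, (s : Set ℂ) ⊆ Λ →
      ∀ (t : ℝ≥0∞), (∀ a ∈ s, depth a ≤ t) → ∀ (c : ℂ → ℂ), ∀ z ∈ Metric.closedBall (0 : ℂ) r,
        ‖szegoSum M s c z‖ₑ ^ p ≤ C * (t * ∑ a ∈ s, ‖c a‖ₑ ^ p * cellArea w a) := by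
  have hv := hw.mul_one_sub_rpow (x := 1) (by linarith [hw.exponent_pos])
  filter_upwards [hv.exists_lintegral_szegoSum_le hΛ hp] with M ⟨C, hC, hint⟩ r hr
  obtain ⟨D, hD, heval⟩ := hv.exists_enorm_rpow_le_lintegral hp hr
  refine ⟨D * C, by finiteness, fun s hs t ht c z hz => ?_⟩
  have hsdisc := hs.trans hΛ.subset_disc
  calc ‖szegoSum M s c z‖ₑ ^ p
      ≤ D * (C * ∑ a ∈ s, ‖c a‖ₑ ^ p * cellArea (fun r => w r * (1 - r) ^ (1 : ℝ)) a) :=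
        (heval _ (differentiableOn_szegoSum hsdisc c) z hz).trans (by gcongr; exact hint s hs c)
    _ ≤ D * (C * ∑ a ∈ s, t * (‖c a‖ₑ ^ p * cellArea w a)) := by
        refine mul_le_mul_right (mul_le_mul_right (Finset.sum_le_sum fun a ha => ?_) _) _
        rw [cellArea_mul_one_sub_rpow (hsdisc ha), ENNReal.rpow_one, ← mul_assoc, mul_comm t]
        gcongr
        exact ht a ha
    _ = D * C * (t * ∑ a ∈ s, ‖c a‖ₑ ^ p * cellArea w a) := by
        rw [← Finset.mul_sum, mul_assoc]

end Synthesis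

section CellMasses

/-- The `lam`-dimensional density of `μ` with respect to the area with weight `om`, on the Whitney
cell of `a`. -/
def cellMass (lam : ℝ) (om : ℝ → ℝ) (μ : Measure ℂ) (a : ℂ) : ℝ≥0∞ :=
  μ (whitneyCell a) / cellArea om a ^ lam

/-- The lattice form of the vanishing Carleson condition: `μ` is finite on compact subsets of the
disc and its densities on the cells at depth less than `t` tend to zero with `t`, in the norm of the
dual of the `ℓ^(1/lam)` sequences (written in terms of `x = |y|^(1/lam)`, so that `ℓ^∞` for
`lam ≥ 1` and `ℓ^(1/(1-lam))` for `lam < 1` are treated at once). -/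
structure HasVanishingCellMasses (Λ : Set ℂ) (lam : ℝ) (om : ℝ → ℝ) (μ : Measure ℂ) : Prop where
  measure_closedBall_lt_top : ∀ r < 1, μ (Metric.closedBall 0 r) < ∞
  exists_sum_le : ∀ ε : ℝ≥0∞, ε ≠ 0 → ∃ t : ℝ, 0 < t ∧ ∀ s : Finset ℂ, ↑s ⊆ Λ →
    (∀ a ∈ s, 1 - ‖a‖ < t) → ∀ x : ℂ → ℝ≥0∞, ∑ a ∈ s, x a ≤ 1 →
    ∑ a ∈ s, cellMass lam om μ a * x a ^ lam ≤ ε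

variable {Λ : Set ℂ} {N : ℕ} {lam : ℝ} {om : ℝ → ℝ} {μ : Measure ℂ}

lemma HasVanishingCellMasses.exists_sum_le_of_sum_le (h : HasVanishingCellMasses Λ lam om μ)
    (hlam : 0 ≤ lam) {Y ε : ℝ≥0∞} (hY : Y ≠ ∞) (hε : ε ≠ 0) :
    ∃ t : ℝ, 0 < t ∧ ∀ s : Finset ℂ, ↑s ⊆ Λ → (∀ a ∈ s, 1 - ‖a‖ < t) → ∀ x : ℂ → ℝ≥0∞,
      ∑ a ∈ s, x a ≤ Y → ∑ a ∈ s, cellMass lam om μ a * x a ^ lam ≤ ε := by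
  have hY0 : max Y 1 ≠ 0 := (zero_lt_one.trans_le (le_max_right Y 1)).ne'
  have hYtop : max Y 1 ≠ ∞ := max_ne_top hY ENNReal.one_ne_top
  have hYlam : max Y 1 ^ lam ≠ ∞ := ENNReal.rpow_ne_top_of_nonneg hlam hYtop
  obtain ⟨t, ht, hsum⟩ := h.exists_sum_le (ε / max Y 1 ^ lam) (ENNReal.div_ne_zero.2 ⟨hε, hYlam⟩)
  refine ⟨t, ht, fun s hs hst x hx => ?_⟩
  have hscaled : ∑ a ∈ s, x a / max Y 1 ≤ 1 := by
    simp only [div_eq_mul_inv]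
    rw [← Finset.sum_mul, ← div_eq_mul_inv]
    exact ENNReal.div_le_of_le_mul (by simpa using hx.trans (le_max_left Y 1))
  calc ∑ a ∈ s, cellMass lam om μ a * x a ^ lam
      = max Y 1 ^ lam * ∑ a ∈ s, cellMass lam om μ a * (x a / max Y 1) ^ lam := by
        rw [Finset.mul_sum]
        refine Finset.sum_congr rfl fun a _ => ?_
        rw [mul_left_comm, ← ENNReal.mul_rpow_of_nonneg _ _ hlam, ENNReal.mul_div_cancel hY0 hYtop]
    _ ≤ max Y 1 ^ lam * (ε / max Y 1 ^ lam) := by gcongr; exact hsum s hs hst _ hscaled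
    _ ≤ ε := ENNReal.mul_div_le

lemma diff_closedBall_subset_iUnion_whitneyCell (hΛ : IsWhitneyLattice Λ N) (t : ℝ) :
    disc \ Metric.closedBall 0 (1 - 3 / 4 * t) ⊆
      ⋃ a ∈ {a ∈ Λ | 1 - ‖a‖ < t}, whitneyCell a := by
  rintro z ⟨hz, hzt⟩
  obtain ⟨a, ha, hza⟩ := Set.mem_iUnion₂.1 (hΛ.disc_subset hz)
  have hnorm : ‖z‖ - ‖a‖ ≤ (1 - ‖a‖) / 4 :=
    (norm_sub_norm_le z a).trans (mem_closedBall_iff_norm.1 hza)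
  rw [mem_closedBall_zero_iff, not_le] at hzt
  exact Set.mem_iUnion₂.2 ⟨a, ⟨ha, by linarith⟩, hza⟩

lemma setLIntegral_biUnion_le {X ι : Type*} [MeasurableSpace X] {ν : Measure X} {T : Set ι}
    (hT : T.Countable) (S : ι → Set X) (g : X → ℝ≥0∞) {ε : ℝ≥0∞}
    (h : ∀ s : Finset ι, ↑s ⊆ T → ∑ a ∈ s, ∫⁻ z in S a, g z ∂ν ≤ ε) :
    ∫⁻ z in ⋃ a ∈ T, S a, g z ∂ν ≤ ε := by
  have := hT.to_subtype
  rw [Set.biUnion_eq_iUnion]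
  refine (lintegral_iUnion_le _ g).trans ?_
  rw [ENNReal.tsum_eq_iSup_sum]
  refine iSup_le fun s => ?_
  have hsum := h (s.map (Function.Embedding.subtype _)) (by simp)
  rwa [Finset.sum_map] at hsum

end CellMasses

section Products

lemma rpow_sum_eq_prod_rpow {κ : Type*} (s : Finset κ) {θ : κ → ℝ} (hθ : ∀ i, 0 ≤ θ i) (y : ℝ≥0∞) :
    y ^ ∑ i ∈ s, θ i = ∏ i ∈ s, y ^ θ i := by
  classical
  induction s using Finset.induction_on with
  | empty => simp
  | insert i s hi ih =>
    rw [Finset.sum_insert hi, Finset.prod_insert hi, ← ih,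
      ENNReal.rpow_add_of_nonneg _ _ (hθ i) (Finset.sum_nonneg fun i _ => hθ i)]

lemma prod_rpow_le_sum_rpow {κ : Type*} (s : Finset κ) {θ : κ → ℝ} (hθ : ∀ i, 0 ≤ θ i)
    (x : κ → ℝ≥0∞) : ∏ i ∈ s, x i ^ θ i ≤ (∑ i ∈ s, x i) ^ ∑ i ∈ s, θ i := by
  rw [rpow_sum_eq_prod_rpow s hθ]
  exact Finset.prod_le_prod' fun i hi =>
    ENNReal.rpow_le_rpow (Finset.single_le_sum_of_canonicallyOrdered hi) (hθ i)

variable {κ : Type*} [Fintype κ]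

/-- The exponent `λ = ∑ qᵢ / pᵢ` of the Carleson condition for the products `∏ |fᵢ| ^ qᵢ` of
functions `fᵢ` from the Bergman spaces of exponents `pᵢ`. -/
def carlesonExponent (p q : κ → ℝ) : ℝ := ∑ i, q i / p i

/-- The weight `∏ wᵢ ^ (qᵢ / (λ pᵢ))` of the Carleson condition for these products, a geometric mean
of the weights `wᵢ`. -/
def meanWeight (p q : κ → ℝ) (w : κ → ℝ → ℝ) : ℝ → ℝ :=
  fun r => ∏ i, w i r ^ (q i / (carlesonExponent p q * p i))

variable {α β p q : κ → ℝ} {w : κ → ℝ → ℝ} {Λ : Set ℂ} {N : ℕ} {μ : Measure ℂ}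

lemma carlesonExponent_pos [Nonempty κ] (hp : ∀ i, 0 < p i) (hq : ∀ i, 0 < q i) :
    0 < carlesonExponent p q :=
  Finset.sum_pos (fun i _ => div_pos (hq i) (hp i)) Finset.univ_nonempty

lemma sum_div_carlesonExponent_mul [Nonempty κ] (hp : ∀ i, 0 < p i) (hq : ∀ i, 0 < q i) :
    ∑ i, q i / (carlesonExponent p q * p i) = 1 := by
  simp only [mul_comm (carlesonExponent p q), ← div_div]
  rw [← Finset.sum_div, ← carlesonExponent, div_self (carlesonExponent_pos hp hq).ne']

lemma exists_isPowerWeight_meanWeight [Nonempty κ] (hw : ∀ i, IsPowerWeight (α i) (β i) (w i))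
    (hp : ∀ i, 0 < p i) (hq : ∀ i, 0 < q i) : ∃ α β, IsPowerWeight α β (meanWeight p q w) :=
  ⟨_, _, .prod_rpow hw
    (fun i => (div_pos (hq i) (mul_pos (carlesonExponent_pos hp hq) (hp i))).le)
    (sum_div_carlesonExponent_mul hp hq)⟩

lemma cellArea_meanWeight_rpow [Nonempty κ] (hw : ∀ i, IsPowerWeight (α i) (β i) (w i))
    (hp : ∀ i, 0 < p i) (hq : ∀ i, 0 < q i) {a : ℂ} (ha : a ∈ disc) :
    cellArea (meanWeight p q w) a ^ carlesonExponent p q = ∏ i, cellArea (w i) a ^ (q i / p i) := by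
  have hlam := carlesonExponent_pos hp hq
  have hpos i : 0 < w i ‖a‖ := (hw i).pos _ ⟨norm_nonneg a, mem_ball_zero_iff.1 ha⟩
  have hexp i : q i / (carlesonExponent p q * p i) * carlesonExponent p q = q i / p i := by
    have := (hp i).ne'
    field_simp
  have hweight : ENNReal.ofReal (meanWeight p q w ‖a‖) ^ carlesonExponent p q =
      ∏ i, ENNReal.ofReal (w i ‖a‖) ^ (q i / p i) := by
    rw [meanWeight, ENNReal.ofReal_prod_of_nonneg fun i _ => (Real.rpow_pos_of_pos (hpos i) _).le,
      ← ENNReal.prod_rpow_of_nonneg hlam.le]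
    refine Finset.prod_congr rfl fun i _ => ?_
    rw [← ENNReal.ofReal_rpow_of_pos (hpos i), ← ENNReal.rpow_mul, hexp]
  have hdepth : (depth a ^ 2) ^ carlesonExponent p q = ∏ i, (depth a ^ 2) ^ (q i / p i) :=
    rpow_sum_eq_prod_rpow _ (fun i => (div_pos (hq i) (hp i)).le) _
  simp only [cellArea, ENNReal.mul_rpow_of_nonneg _ _ hlam.le,
    fun i => ENNReal.mul_rpow_of_nonneg (ENNReal.ofReal (w i ‖a‖)) (depth a ^ 2)
      (div_pos (hq i) (hp i)).le, Finset.prod_mul_distrib, hweight, hdepth]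

lemma setLIntegral_prod_rpow_le [Nonempty κ] (hw : ∀ i, IsPowerWeight (α i) (β i) (w i))
    (hp : ∀ i, 0 < p i) (hq : ∀ i, 0 < q i) {a : ℂ} (ha : a ∈ disc) {f : κ → ℂ → ℂ}
    {S : κ → ℝ≥0∞}
    (hS : ∀ i, ∀ z ∈ whitneyCell a, cellArea (w i) a * ‖f i z‖ₑ ^ p i ≤ S i) :
    ∫⁻ z in whitneyCell a, ∏ i, ‖f i z‖ₑ ^ q i ∂μ ≤
      cellMass (carlesonExponent p q) (meanWeight p q w) μ a * ∏ i, S i ^ (q i / p i) := by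
  obtain ⟨_, _, hom⟩ := exists_isPowerWeight_meanWeight hw hp hq
  have hlam := carlesonExponent_pos hp hq
  set A := cellArea (meanWeight p q w) a ^ carlesonExponent p q with hA
  have hA0 : A ≠ 0 := (ENNReal.rpow_pos (pos_iff_ne_zero.2 (hom.cellArea_ne_zero ha))
    cellArea_ne_top).ne'
  have hAtop : A ≠ ∞ := ENNReal.rpow_ne_top_of_nonneg hlam.le cellArea_ne_top
  have hbound : ∀ z ∈ whitneyCell a, ∏ i, ‖f i z‖ₑ ^ q i ≤ (∏ i, S i ^ (q i / p i)) / A := by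
    intro z hz
    rw [ENNReal.le_div_iff_mul_le (.inl hA0) (.inl hAtop), hA,
      cellArea_meanWeight_rpow hw hp hq ha, ← Finset.prod_mul_distrib]
    refine Finset.prod_le_prod' fun i _ => ?_
    have hqp := (div_pos (hq i) (hp i)).le
    calc ‖f i z‖ₑ ^ q i * cellArea (w i) a ^ (q i / p i)
        = (cellArea (w i) a * ‖f i z‖ₑ ^ p i) ^ (q i / p i) := by
          rw [ENNReal.mul_rpow_of_nonneg _ _ hqp, ← ENNReal.rpow_mul,
            mul_div_cancel₀ _ (hp i).ne', mul_comm]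
      _ ≤ S i ^ (q i / p i) := ENNReal.rpow_le_rpow (hS i z hz) hqp
  calc ∫⁻ z in whitneyCell a, ∏ i, ‖f i z‖ₑ ^ q i ∂μ
      ≤ ∫⁻ _ in whitneyCell a, (∏ i, S i ^ (q i / p i)) / A ∂μ :=
        setLIntegral_mono' measurableSet_closedBall hbound
    _ = cellMass (carlesonExponent p q) (meanWeight p q w) μ a * ∏ i, S i ^ (q i / p i) := by
        rw [setLIntegral_const, cellMass, ← hA, div_eq_mul_inv, div_eq_mul_inv]
        ring

theorem exists_setLIntegral_whitneyCell_le [Nonempty κ] (hw : ∀ i, IsPowerWeight (α i) (β i) (w i))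
    (hp : ∀ i, 0 < p i) (hq : ∀ i, 0 < q i) :
    ∃ C : ℝ≥0∞, C ≠ ∞ ∧ ∀ f : κ → ℂ → ℂ, (∀ i, DifferentiableOn ℂ (f i) disc) → ∀ a ∈ disc,
      ∫⁻ z in whitneyCell a, ∏ i, ‖f i z‖ₑ ^ q i ∂μ ≤
        C * (cellMass (carlesonExponent p q) (meanWeight p q w) μ a *
          (∑ i, ∫⁻ z in whitneyBall a, ‖f i z‖ₑ ^ p i ∂weightedArea (w i)) ^
            carlesonExponent p q) := by
  choose C hC hle using fun i => (hw i).exists_cellArea_mul_enorm_rpow_le (hp i)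
  have hqp i : 0 ≤ q i / p i := (div_pos (hq i) (hp i)).le
  refine ⟨∏ i, C i ^ (q i / p i), ENNReal.prod_ne_top fun i _ =>
    ENNReal.rpow_ne_top_of_nonneg (hqp i) (hC i), fun f hf a ha => ?_⟩
  refine (setLIntegral_prod_rpow_le hw hp hq ha fun i => hle i (f i) (hf i) a ha).trans ?_
  simp only [fun i => ENNReal.mul_rpow_of_nonneg (C i) (∫⁻ z in whitneyBall a, ‖f i z‖ₑ ^ p i
    ∂weightedArea (w i)) (hqp i), Finset.prod_mul_distrib]
  rw [mul_left_comm]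
  gcongr
  exact prod_rpow_le_sum_rpow _ hqp _

end Products

section Sufficiency

variable {κ : Type*} [Fintype κ] {α β p q : κ → ℝ} {w : κ → ℝ → ℝ}
  {Λ : Set ℂ} {N : ℕ} {μ : Measure ℂ} {B ε : ℝ≥0∞}

lemma IsWhitneyLattice.sum_sum_setLIntegral_le (hΛ : IsWhitneyLattice Λ N) {s : Finset ℂ}
    (hs : ↑s ⊆ Λ) {f : κ → ℂ → ℂ} (hfB : ∀ i, ∫⁻ z, ‖f i z‖ₑ ^ p i ∂weightedArea (w i) ≤ B) :
    ∑ a ∈ s, ∑ i, ∫⁻ z in whitneyBall a, ‖f i z‖ₑ ^ p i ∂weightedArea (w i) ≤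
      Fintype.card κ * (N * B) := by
  rw [Finset.sum_comm, ← nsmul_eq_mul, ← Finset.card_univ]
  refine Finset.sum_le_card_nsmul _ _ _ fun i _ => ?_
  calc ∑ a ∈ s, ∫⁻ z in whitneyBall a, ‖f i z‖ₑ ^ p i ∂weightedArea (w i)
      ≤ N * ∫⁻ z in disc, ‖f i z‖ₑ ^ p i ∂weightedArea (w i) := hΛ.sum_setLIntegral_le _ _ hs
    _ ≤ N * B := by gcongr; exact (setLIntegral_le_lintegral _ _).trans (hfB i)

theorem HasVanishingCellMasses.exists_setLIntegral_diff_le [Nonempty κ]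
    (h : HasVanishingCellMasses Λ (carlesonExponent p q) (meanWeight p q w) μ)
    (hΛ : IsWhitneyLattice Λ N) (hw : ∀ i, IsPowerWeight (α i) (β i) (w i))
    (hp : ∀ i, 0 < p i) (hq : ∀ i, 0 < q i) (hB : B ≠ ∞) (hε : ε ≠ 0) :
    ∃ r < 1, ∀ f : κ → ℂ → ℂ, (∀ i, DifferentiableOn ℂ (f i) disc) →
      (∀ i, ∫⁻ z, ‖f i z‖ₑ ^ p i ∂weightedArea (w i) ≤ B) →
      ∫⁻ z in disc \ Metric.closedBall 0 r, ∏ i, ‖f i z‖ₑ ^ q i ∂μ ≤ ε := by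
  obtain ⟨C, hC, hcell⟩ := exists_setLIntegral_whitneyCell_le (μ := μ) hw hp hq
  obtain ⟨t, ht, hsum⟩ := h.exists_sum_le_of_sum_le (carlesonExponent_pos hp hq).le
    (Y := Fintype.card κ * (N * B)) (ε := ε / C) (by finiteness) (ENNReal.div_ne_zero.2 ⟨hε, hC⟩)
  refine ⟨1 - 3 / 4 * t, by linarith, fun f hf hfB => ?_⟩
  refine (lintegral_mono_set (diff_closedBall_subset_iUnion_whitneyCell hΛ t)).trans ?_
  refine setLIntegral_biUnion_le (hΛ.countable.mono (Set.sep_subset _ _)) _ _ fun s hs => ?_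
  have hsΛ : ↑s ⊆ Λ := fun a ha => (hs ha).1
  calc ∑ a ∈ s, ∫⁻ z in whitneyCell a, ∏ i, ‖f i z‖ₑ ^ q i ∂μ
      ≤ ∑ a ∈ s, C * (cellMass (carlesonExponent p q) (meanWeight p q w) μ a *
          (∑ i, ∫⁻ z in whitneyBall a, ‖f i z‖ₑ ^ p i ∂weightedArea (w i)) ^
            carlesonExponent p q) :=
        Finset.sum_le_sum fun a ha => hcell f hf a (hΛ.subset_disc (hsΛ ha))
    _ ≤ C * (ε / C) := by
        rw [← Finset.mul_sum]
        gcongr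
        exact hsum s hsΛ (fun a ha => (hs ha).2) _ (hΛ.sum_sum_setLIntegral_le hsΛ hfB)
    _ ≤ ε := ENNReal.mul_div_le

lemma exists_prod_enorm_rpow_le (hw : ∀ i, IsPowerWeight (α i) (β i) (w i))
    (hp : ∀ i, 0 < p i) (hq : ∀ i, 0 < q i) (hB : B ≠ ∞) {r : ℝ} (hr : r < 1) (i₀ : κ) :
    ∃ C : ℝ≥0∞, C ≠ ∞ ∧ ∀ f : κ → ℂ → ℂ, (∀ i, DifferentiableOn ℂ (f i) disc) →
      (∀ i, ∫⁻ z, ‖f i z‖ₑ ^ p i ∂weightedArea (w i) ≤ B) →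
      ∀ z ∈ Metric.closedBall 0 r, ∏ i, ‖f i z‖ₑ ^ q i ≤ ‖f i₀ z‖ₑ ^ q i₀ * C := by
  classical
  choose C hC hle using fun i => (hw i).exists_enorm_rpow_le_lintegral (hp i) hr
  have hqp i : 0 ≤ q i / p i := (div_pos (hq i) (hp i)).le
  refine ⟨∏ i ∈ Finset.univ.erase i₀, (C i * B) ^ (q i / p i), ENNReal.prod_ne_top fun i _ =>
    ENNReal.rpow_ne_top_of_nonneg (hqp i) (ENNReal.mul_ne_top (hC i) hB), fun f hf hfB z hz => ?_⟩
  rw [← Finset.mul_prod_erase _ _ (Finset.mem_univ i₀)]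
  gcongr with i
  calc ‖f i z‖ₑ ^ q i = (‖f i z‖ₑ ^ p i) ^ (q i / p i) := by
        rw [← ENNReal.rpow_mul, mul_div_cancel₀ _ (hp i).ne']
    _ ≤ (C i * B) ^ (q i / p i) :=
        ENNReal.rpow_le_rpow ((hle i (f i) (hf i) z hz).trans (mul_le_mul_right (hfB i) _)) (hqp i)

theorem HasVanishingCellMasses.exists_setLIntegral_prod_le
    (h : HasVanishingCellMasses Λ (carlesonExponent p q) (meanWeight p q w) μ)
    (hΛ : IsWhitneyLattice Λ N) (hw : ∀ i, IsPowerWeight (α i) (β i) (w i))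
    (hp : ∀ i, 0 < p i) (hq : ∀ i, 0 < q i) (hB : B ≠ ∞) (hε : ε ≠ 0) (i₀ : κ) :
    ∃ r < 1, ∃ δ : ℝ, 0 < δ ∧ ∀ f : κ → ℂ → ℂ, (∀ i, DifferentiableOn ℂ (f i) disc) →
      (∀ i, ∫⁻ z, ‖f i z‖ₑ ^ p i ∂weightedArea (w i) ≤ B) →
      (∀ z ∈ Metric.closedBall 0 r, ‖f i₀ z‖ < δ) →
      ∫⁻ z in disc, ∏ i, ‖f i z‖ₑ ^ q i ∂μ ≤ ε := by
  have : Nonempty κ := ⟨i₀⟩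
  obtain ⟨r, hr, htail⟩ := h.exists_setLIntegral_diff_le hΛ hw hp hq hB (ENNReal.half_pos hε).ne'
  obtain ⟨C, hC, hprod⟩ := exists_prod_enorm_rpow_le hw hp hq hB hr i₀
  obtain ⟨η, hη, hηε⟩ := ENNReal.exists_nnreal_pos_mul_lt
    (ENNReal.mul_ne_top hC (h.measure_closedBall_lt_top r hr).ne) (ENNReal.half_pos hε).ne'
  refine ⟨r, hr, (η : ℝ) ^ (q i₀)⁻¹, by positivity, fun f hf hfB hsmall => ?_⟩
  have hcore : ∀ z ∈ Metric.closedBall 0 r, ∏ i, ‖f i z‖ₑ ^ q i ≤ η * C := by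
    intro z hz
    refine (hprod f hf hfB z hz).trans ?_
    gcongr
    rw [← ENNReal.le_rpow_inv_iff (hq i₀), ← ENNReal.ofReal_coe_nnreal,
      ENNReal.ofReal_rpow_of_pos (NNReal.coe_pos.2 hη), ← ofReal_norm]
    exact ENNReal.ofReal_le_ofReal (hsmall z hz).le
  calc ∫⁻ z in disc, ∏ i, ‖f i z‖ₑ ^ q i ∂μ
      ≤ ∫⁻ z in Metric.closedBall 0 r ∪ disc \ Metric.closedBall 0 r, ∏ i, ‖f i z‖ₑ ^ q i ∂μ :=
        lintegral_mono_set (Set.union_sdiff_self.symm ▸ Set.subset_union_right)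
    _ ≤ ∫⁻ _ in Metric.closedBall 0 r, η * C ∂μ +
          ∫⁻ z in disc \ Metric.closedBall 0 r, ∏ i, ‖f i z‖ₑ ^ q i ∂μ :=
        (lintegral_union_le _ _ _).trans
          (add_le_add_left (setLIntegral_mono' measurableSet_closedBall hcore) _)
    _ ≤ ε / 2 + ε / 2 := by
        rw [setLIntegral_const, mul_assoc]
        exact add_le_add hηε.le (htail f hf hfB)
    _ = ε := ENNReal.add_halves ε

end Sufficiency

section NormalFamilies

lemma equicontinuousAt_of_forall_exists_norm_le {U : Set ℂ} (hU : IsOpen U) {ι : Type*}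
    {f : ι → ℂ → ℂ} (hf : ∀ k, DifferentiableOn ℂ (f k) U)
    (hb : ∀ K ⊆ U, IsCompact K → ∃ C, ∀ k, ∀ z ∈ K, ‖f k z‖ ≤ C) {x : ℂ} (hx : x ∈ U) :
    EquicontinuousAt f x := by
  obtain ⟨ρ, hρ, hρU⟩ := Metric.nhds_basis_closedBall.mem_iff.1 (hU.mem_nhds hx)
  obtain ⟨C, hC⟩ := hb _ hρU (isCompact_closedBall x ρ)
  refine Metric.equicontinuousAt_of_continuity_modulus (fun y => (C + C) / ρ * dist y x) ?_ f ?_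
  · exact Continuous.tendsto' (by fun_prop) _ _ (by simp)
  · filter_upwards [Metric.ball_mem_nhds x hρ] with y hy k
    rw [dist_comm]
    refine Complex.dist_le_div_mul_dist_of_mapsTo_ball
      ((hf k).mono (Metric.ball_subset_closedBall.trans hρU)) (fun z hz => ?_) hy
    exact (dist_le_norm_add_norm _ _).trans (add_le_add (hC k z (Metric.ball_subset_closedBall hz))
      (hC k x (Metric.mem_closedBall_self hρ.le)))

theorem exists_subseq_tendstoLocallyUniformlyOn {U : Set ℂ} (hU : IsOpen U) {f : ℕ → ℂ → ℂ}
    (hf : ∀ k, DifferentiableOn ℂ (f k) U)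
    (hb : ∀ K ⊆ U, IsCompact K → ∃ C, ∀ k, ∀ z ∈ K, ‖f k z‖ ≤ C) :
    ∃ g, DifferentiableOn ℂ g U ∧ ∃ φ : ℕ → ℕ, StrictMono φ ∧
      TendstoLocallyUniformlyOn (fun k => f (φ k)) g atTop U := by
  have : LocallyCompactSpace U := hU.locallyCompactSpace
  let F (k : ℕ) : C(U, ℂ) := ⟨U.domRestrict (f k), (hf k).continuousOn.domRestrict⟩
  have : T2Space (UniformOnFun U ℂ {K | IsCompact K}) :=
    UniformOnFun.t2Space_of_covering
      (Set.eq_univ_of_forall fun z => ⟨{z}, isCompact_singleton, rfl⟩)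
  have hcompact : IsCompact (closure (Set.range F)) := by
    refine ArzelaAscoli.isCompact_closure_of_isClosedEmbedding (F := fun G : C(U, ℂ) => ⇑G)
      (fun K hK => hK) ContinuousMap.isUniformEmbedding_toUniformOnFunIsCompact.isClosedEmbedding
      ?_ fun _ _ x _ => ?_
    · refine fun K _ x _ => EquicontinuousAt.equicontinuousWithinAt (fun V hV => ?_) K
      filter_upwards [continuous_subtype_val.continuousAt.eventually
        (equicontinuousAt_of_forall_exists_norm_le hU hf hb x.2 V hV)] with y hy
      rintro ⟨_, k, rfl⟩
      exact hy k
    · obtain ⟨C, hC⟩ := hb {↑x} (Set.singleton_subset_iff.2 x.2) isCompact_singleton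
      refine ⟨Metric.closedBall 0 C, isCompact_closedBall 0 C, ?_⟩
      rintro _ ⟨k, rfl⟩
      exact mem_closedBall_zero_iff.2 (hC k x rfl)
  obtain ⟨G, -, φ, hφ, hlim⟩ :=
    hcompact.tendsto_subseq fun k => subset_closure (Set.mem_range_self k)
  have hloc : TendstoLocallyUniformlyOn (fun k => f (φ k)) (Function.extend Subtype.val G 0)
      atTop U := by
    rw [tendstoLocallyUniformlyOn_iff_tendstoLocallyUniformly_comp_coe,
      Function.extend_comp Subtype.val_injective]
    exact ContinuousMap.tendsto_iff_tendstoLocallyUniformly.1 hlim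
  exact ⟨_, hloc.differentiableOn (.of_forall fun k => hf (φ k)) hU, φ, hφ, hloc⟩

end NormalFamilies

section NullSequences

variable {α β p q : ℝ} {w : ℝ → ℝ} {f : ℕ → ℂ → ℂ} {g : ℂ → ℂ} {μ : Measure ℂ}

lemma aestronglyMeasurable_weightedArea (hg : DifferentiableOn ℂ g disc) (w : ℝ → ℝ) :
    AEStronglyMeasurable g (weightedArea w) := by
  rw [← weightedArea_restrict_disc]
  exact hg.continuousOn.aestronglyMeasurable measurableSet_ball

lemma bergmanNorm_const_smul (c : ℂ) (g : ℂ → ℂ) :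
    bergmanNorm p w (c • g) = ‖c‖ₑ * bergmanNorm p w g :=
  eLpNorm_const_smul c g _ _

lemma const_smul_mem_bergmanSpace (c : ℂ) (hg : g ∈ bergmanSpace p w) :
    c • g ∈ bergmanSpace p w :=
  ⟨hg.1.const_smul c, by
    rw [bergmanNorm_const_smul]
    exact ENNReal.mul_lt_top enorm_lt_top hg.2⟩

lemma BoundedSeq.comp (hf : BoundedSeq p w f) (φ : ℕ → ℕ) : BoundedSeq p w (f ∘ φ) :=
  ⟨fun k => hf.1 (φ k), hf.2.imp fun _ hC k => hC (φ k)⟩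

lemma BoundedSeq.exists_lintegral_le (hp : 0 < p) (hf : BoundedSeq p w f) :
    ∃ B : ℝ≥0∞, B ≠ ∞ ∧ ∀ k, ∫⁻ z, ‖f k z‖ₑ ^ p ∂weightedArea w ≤ B := by
  obtain ⟨C, hC⟩ := hf.2
  refine ⟨C ^ p, ENNReal.rpow_ne_top_of_nonneg hp.le ENNReal.coe_ne_top, fun k => ?_⟩
  rw [← bergmanNorm_rpow hp]
  exact ENNReal.rpow_le_rpow (hC k) hp.le

lemma BoundedSeq.sub_const (hf : BoundedSeq p w f) (hg : g ∈ bergmanSpace p w) :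
    BoundedSeq p w fun k => f k - g := by
  obtain ⟨C, hC⟩ := hf.2
  have hbound (k : ℕ) : bergmanNorm p w (f k - g) ≤
      ENNReal.LpAddConst (ENNReal.ofReal p) * (C + bergmanNorm p w g) :=
    (eLpNorm_sub_le' (aestronglyMeasurable_weightedArea (hf.1 k).1 w)
      (aestronglyMeasurable_weightedArea hg.1 w) _).trans
      (mul_le_mul_right (add_le_add_left (hC k) _) _)
  have hfin : ENNReal.LpAddConst (ENNReal.ofReal p) * (C + bergmanNorm p w g) ≠ ∞ :=
    ENNReal.mul_ne_top (ENNReal.LpAddConst_lt_top _).ne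
      (ENNReal.add_ne_top.2 ⟨ENNReal.coe_ne_top, hg.2.ne⟩)
  refine ⟨fun k => ⟨(hf.1 k).1.sub hg.1, (hbound k).trans_lt hfin.lt_top⟩,
    ENNReal.toNNReal (ENNReal.LpAddConst (ENNReal.ofReal p) * (C + bergmanNorm p w g)), fun k => ?_⟩
  rw [ENNReal.coe_toNNReal hfin]
  exact hbound k

lemma BoundedSeq.exists_norm_le_of_isCompact (hw : IsPowerWeight α β w) (hp : 0 < p)
    (hf : BoundedSeq p w f) {K : Set ℂ} (hKd : K ⊆ disc) (hK : IsCompact K) :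
    ∃ C, ∀ k, ∀ z ∈ K, ‖f k z‖ ≤ C := by
  obtain ⟨r, hr, hKr⟩ := exists_lt_subset_ball hK.isClosed hKd
  obtain ⟨C, hC, hle⟩ := hw.exists_enorm_rpow_le_lintegral hp hr
  obtain ⟨B, hB, hfB⟩ := hf.exists_lintegral_le hp
  have hfin : (C * B) ^ p⁻¹ ≠ ∞ :=
    ENNReal.rpow_ne_top_of_nonneg (inv_nonneg.2 hp.le) (ENNReal.mul_ne_top hC hB)
  refine ⟨((C * B) ^ p⁻¹).toReal, fun k z hz => ?_⟩
  rw [← toReal_enorm]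
  refine ENNReal.toReal_mono hfin ((ENNReal.le_rpow_inv_iff hp).2 ?_)
  exact (hle _ (hf.1 k).1 z (Metric.ball_subset_closedBall (hKr hz))).trans
    (mul_le_mul_right (hfB k) _)

lemma BoundedSeq.mem_bergmanSpace_of_tendstoLocallyUniformlyOn (hf : BoundedSeq p w f)
    (hg : TendstoLocallyUniformlyOn f g atTop disc) : g ∈ bergmanSpace p w := by
  obtain ⟨C, hC⟩ := hf.2
  refine ⟨hg.differentiableOn (.of_forall fun k => (hf.1 k).1) Metric.isOpen_ball, ?_⟩
  refine lt_of_le_of_lt ?_ (ENNReal.coe_lt_top (r := C))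
  refine (Lp.eLpNorm_lim_le_liminf_eLpNorm
    (fun k => aestronglyMeasurable_weightedArea (hf.1 k).1 w) g ?_).trans
    (liminf_le_of_frequently_le' (.of_forall hC))
  filter_upwards [ae_mem_disc] with z hz using hg.tendsto_at hz

lemma tendstoZeroOnCompacts_sub (hg : TendstoLocallyUniformlyOn f g atTop disc) :
    TendstoZeroOnCompacts fun k => f k - g := by
  intro K hKd hK
  have hgK := (tendstoLocallyUniformlyOn_iff_forall_isCompact Metric.isOpen_ball).1 hg K hKd hK
  rw [Metric.tendstoUniformlyOn_iff] at hgK ⊢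
  simpa [dist_eq_norm, norm_sub_rev] using hgK

theorem BoundedSeq.exists_subseq_tendstoZeroOnCompacts (hw : IsPowerWeight α β w) (hp : 0 < p)
    (hf : BoundedSeq p w f) :
    ∃ g ∈ bergmanSpace p w, ∃ φ : ℕ → ℕ, StrictMono φ ∧ BoundedSeq p w (fun k => f (φ k) - g) ∧
      TendstoZeroOnCompacts fun k => f (φ k) - g := by
  obtain ⟨g, -, φ, hφ, hlim⟩ := exists_subseq_tendstoLocallyUniformlyOn Metric.isOpen_ball
    (fun k => (hf.1 k).1) fun K => hf.exists_norm_le_of_isCompact hw hp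
  have hg := (hf.comp φ).mem_bergmanSpace_of_tendstoLocallyUniformlyOn hlim
  exact ⟨g, hg, φ, hφ, (hf.comp φ).sub_const hg, tendstoZeroOnCompacts_sub hlim⟩

end NullSequences

section VanishingCarleson

variable {α β p q : ℝ} {w : ℝ → ℝ} {f : ℕ → ℂ → ℂ} {g : ℂ → ℂ} {μ : Measure ℂ}

lemma IsVanishingCarleson.tendsto_eLpNorm (hq : 0 < q) (h : IsVanishingCarleson q p w μ)
    (hf : BoundedSeq p w f) (hf0 : TendstoZeroOnCompacts f) :
    Tendsto (fun k => eLpNorm (f k) (ENNReal.ofReal q) (μ.restrict disc)) atTop (𝓝 0) := by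
  refine tendsto_of_subseq_tendsto fun ns hns => ?_
  obtain ⟨g, hg, φ, hφ, hlim⟩ := h.2 _ (hf.comp ns)
  have hmeas (k : ℕ) : AEStronglyMeasurable (f (ns (φ k))) (μ.restrict disc) :=
    (hf.1 _).1.continuousOn.aestronglyMeasurable measurableSet_ball
  obtain ⟨ms, hms, hae⟩ := (tendstoInMeasure_of_tendsto_eLpNorm
    (ENNReal.ofReal_ne_zero_iff.2 hq) hmeas hg.1 hlim).exists_seq_tendsto_ae
  have hg0 : g =ᵐ[μ.restrict disc] 0 := by
    filter_upwards [hae, ae_restrict_mem measurableSet_ball] with z hz hzd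
    have hfz : Tendsto (fun k => f k z) atTop (𝓝 0) :=
      (hf0 {z} (Set.singleton_subset_iff.2 hzd) isCompact_singleton).tendsto_at rfl
    exact tendsto_nhds_unique hz
      (hfz.comp (hns.comp (hφ.tendsto_atTop.comp hms.tendsto_atTop)))
  refine ⟨φ, hlim.congr fun k => eLpNorm_congr_ae ?_⟩
  filter_upwards [hg0] with z hz
  simp [hz]

lemma tendstoZeroOnCompacts_smul {c : ℕ → ℂ} (hc : Tendsto c atTop (𝓝 0))
    (hg : ContinuousOn g disc) : TendstoZeroOnCompacts fun k => c k • g := by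
  intro K hKd hK
  obtain ⟨C, hC⟩ := hK.exists_bound_of_continuousOn (hg.mono hKd)
  have hlim : Tendsto (fun k => ‖c k‖ * C) atTop (𝓝 0) := by
    simpa using hc.norm.mul_const C
  rw [Metric.tendstoUniformlyOn_iff]
  intro ε hε
  filter_upwards [hlim.eventually_lt_const hε] with k hk z hz
  rw [dist_zero_left, Pi.smul_apply, norm_smul]
  exact (mul_le_mul_of_nonneg_left (hC z hz) (norm_nonneg _)).trans_lt hk

lemma boundedSeq_smul {c : ℕ → ℂ} (hc : ∀ k, ‖c k‖ ≤ 1) (hg : g ∈ bergmanSpace p w) :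
    BoundedSeq p w fun k => c k • g := by
  refine ⟨fun k => const_smul_mem_bergmanSpace _ hg, (bergmanNorm p w g).toNNReal, fun k => ?_⟩
  rw [bergmanNorm_const_smul, ENNReal.coe_toNNReal hg.2.ne]
  refine mul_le_of_le_one_left' ?_
  simpa [← ofReal_norm] using hc k

lemma memLp_of_forall_tendsto_eLpNorm
    (h : ∀ f, BoundedSeq p w f → TendstoZeroOnCompacts f →
      Tendsto (fun k => eLpNorm (f k) (ENNReal.ofReal q) (μ.restrict disc)) atTop (𝓝 0))
    (hg : g ∈ bergmanSpace p w) : MemLp g (ENNReal.ofReal q) (μ.restrict disc) := by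
  have hhalf : ‖(2⁻¹ : ℂ)‖ < 1 := by norm_num
  obtain ⟨k, hk⟩ := ((h _
    (boundedSeq_smul (fun k => (norm_pow_le _ k).trans (pow_le_one₀ (norm_nonneg _) hhalf.le)) hg)
    (tendstoZeroOnCompacts_smul (tendsto_pow_atTop_nhds_zero_of_norm_lt_one hhalf)
      hg.1.continuousOn)).eventually_lt_const zero_lt_one).exists
  refine ⟨hg.1.continuousOn.aestronglyMeasurable measurableSet_ball, ?_⟩
  rw [eLpNorm_const_smul] at hk
  exact ENNReal.lt_top_of_mul_ne_top_right hk.ne_top (enorm_ne_zero.2 (pow_ne_zero k (by norm_num)))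

theorem isVanishingCarleson_iff (hw : IsPowerWeight α β w) (hp : 0 < p) (hq : 0 < q) :
    IsVanishingCarleson q p w μ ↔ ∀ f, BoundedSeq p w f → TendstoZeroOnCompacts f →
      Tendsto (fun k => eLpNorm (f k) (ENNReal.ofReal q) (μ.restrict disc)) atTop (𝓝 0) := by
  refine ⟨fun h f => h.tendsto_eLpNorm hq, fun h => ⟨fun g hg => ?_, fun f hf => ?_⟩⟩
  · exact memLp_of_forall_tendsto_eLpNorm h hg
  · obtain ⟨g, hg, φ, hφ, hb, h0⟩ := hf.exists_subseq_tendstoZeroOnCompacts hw hp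
    exact ⟨g, memLp_of_forall_tendsto_eLpNorm h hg, φ, hφ, h _ hb h0⟩

end VanishingCarleson

section NullSequenceCriterion

variable {κ : Type*} [Fintype κ]

/-- Condition (iii): the integrals of the products `∏ |fᵢₖ| ^ qᵢ` tend to zero for all bounded
sequences that tend to zero locally uniformly. -/
def VanishesOnNullSequences (p q : κ → ℝ) (w : κ → ℝ → ℝ) (μ : Measure ℂ) : Prop :=
  ∀ f : κ → ℕ → ℂ → ℂ, (∀ i, BoundedSeq (p i) (w i) (f i)) → (∀ i, TendstoZeroOnCompacts (f i)) →
    Tendsto (fun k : ℕ => ∫⁻ z in disc, ∏ i, ‖f i k z‖ₑ ^ q i ∂μ) atTop (𝓝 0)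

lemma tendsto_lintegral_enorm_rpow_iff {q : ℝ} (hq : 0 < q) (f : ℕ → ℂ → ℂ) (ν : Measure ℂ) :
    Tendsto (fun k => ∫⁻ z, ‖f k z‖ₑ ^ q ∂ν) atTop (𝓝 0) ↔
      Tendsto (fun k => eLpNorm (f k) (ENNReal.ofReal q) ν) atTop (𝓝 0) := by
  have hnorm (k : ℕ) : eLpNorm (f k) (ENNReal.ofReal q) ν = (∫⁻ z, ‖f k z‖ₑ ^ q ∂ν) ^ q⁻¹ := by
    rw [eLpNorm_eq_lintegral_rpow_enorm_toReal (ENNReal.ofReal_ne_zero_iff.2 hq)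
      ENNReal.ofReal_ne_top, ENNReal.toReal_ofReal hq.le, one_div]
  simp only [hnorm]
  refine ⟨fun h => ?_, fun h => ?_⟩
  · simpa [ENNReal.zero_rpow_of_pos (inv_pos.2 hq)] using h.ennrpow_const q⁻¹
  · simpa [ENNReal.zero_rpow_of_pos hq, ENNReal.rpow_inv_rpow hq.ne'] using h.ennrpow_const q

theorem isVanishingCarleson_iff_vanishesOnNullSequences {α β p q : ℝ} {w : ℝ → ℝ} {μ : Measure ℂ}
    (hw : IsPowerWeight α β w) (hp : 0 < p) (hq : 0 < q) :
    IsVanishingCarleson q p w μ ↔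
      VanishesOnNullSequences (fun _ : Unit => p) (fun _ => q) (fun _ => w) μ := by
  rw [isVanishingCarleson_iff hw hp hq]
  simp only [VanishesOnNullSequences, ← tendsto_lintegral_enorm_rpow_iff hq, Finset.univ_unique,
    Finset.prod_singleton]
  exact ⟨fun h f hf hf0 => h (f default) (hf _) (hf0 _),
    fun h f hf hf0 => h (fun _ => f) (fun _ => hf) fun _ => hf0⟩

lemma carlesonExponent_unit (p q : ℝ) :
    carlesonExponent (fun _ : Unit => p) (fun _ => q) = q / p := by
  simp [carlesonExponent]

lemma meanWeight_unit {p q : ℝ} (hp : 0 < p) (hq : 0 < q) (w : ℝ → ℝ) :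
    meanWeight (fun _ : Unit => p) (fun _ => q) (fun _ => w) = w := by
  funext r
  simp [meanWeight, carlesonExponent_unit, hp.ne', hq.ne']

theorem HasVanishingCellMasses.vanishesOnNullSequences [Nonempty κ] {α β p q : κ → ℝ}
    {w : κ → ℝ → ℝ} {Λ : Set ℂ} {N : ℕ} {μ : Measure ℂ}
    (h : HasVanishingCellMasses Λ (carlesonExponent p q) (meanWeight p q w) μ)
    (hΛ : IsWhitneyLattice Λ N) (hw : ∀ i, IsPowerWeight (α i) (β i) (w i))
    (hp : ∀ i, 0 < p i) (hq : ∀ i, 0 < q i) : VanishesOnNullSequences p q w μ := by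
  intro f hf hf0
  choose B hB hfB using fun i => (hf i).exists_lintegral_le (hp i)
  refine ENNReal.tendsto_nhds_zero.2 fun ε hε => ?_
  let i₀ : κ := Classical.arbitrary κ
  obtain ⟨r, hr, δ, hδ, hsmall⟩ := h.exists_setLIntegral_prod_le hΛ hw hp hq
    (ENNReal.sum_ne_top.2 fun i _ => hB i) hε.ne' i₀
  have hball : Metric.closedBall 0 r ⊆ disc := Metric.closedBall_subset_ball hr
  filter_upwards [Metric.tendstoUniformlyOn_iff.1 (hf0 i₀ _ hball (isCompact_closedBall 0 r)) δ hδ]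
    with k hk
  exact hsmall (fun i => f i k) (fun i => ((hf i).1 k).1)
    (fun i => (hfB i k).trans (Finset.single_le_sum_of_canonicallyOrdered (Finset.mem_univ i)))
    fun z hz => by simpa using hk z hz

end NullSequenceCriterion

section RandomSubsets

variable {ι κ : Type*} [Fintype κ] {q : κ → ℝ}

lemma enorm_rpow_le_of_sub_eq {E : Type*} [SeminormedAddCommGroup E] {u v w : E} (huv : v - w = u)
    {q : ℝ} (hq : 0 ≤ q) : ‖u‖ₑ ^ q ≤ 2 ^ q * (‖v‖ₑ ^ q + ‖w‖ₑ ^ q) := by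
  have hmax : ‖u‖ₑ ≤ 2 * max ‖v‖ₑ ‖w‖ₑ := by
    rw [← huv, two_mul]
    exact enorm_sub_le.trans (add_le_add (le_max_left _ _) (le_max_right _ _))
  refine (ENNReal.rpow_le_rpow hmax hq).trans ?_
  rw [ENNReal.mul_rpow_of_nonneg _ _ hq, (ENNReal.monotone_rpow_of_nonneg hq).map_max]
  gcongr
  exact max_le_add_of_nonneg zero_le zero_le

-- Every term is the difference of the sums over two subsets, with and without that term.
lemma card_powerset_mul_enorm_rpow_le {E : Type*} [SeminormedAddCommGroup E] (u : ι → E)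
    {s : Finset ι} {a : ι} (ha : a ∈ s) {q : ℝ} (hq : 0 ≤ q) :
    (s.powerset.card : ℝ≥0∞) * ‖u a‖ₑ ^ q ≤
      2 * 2 ^ q * ∑ t ∈ s.powerset, ‖∑ b ∈ t, u b‖ₑ ^ q := by
  classical
  obtain ⟨s, has, rfl⟩ : ∃ s', a ∉ s' ∧ insert a s' = s :=
    ⟨s.erase a, Finset.notMem_erase a s, Finset.insert_erase ha⟩
  have hpair : ∀ t ∈ s.powerset,
      ‖u a‖ₑ ^ q ≤ 2 ^ q * (‖∑ b ∈ insert a t, u b‖ₑ ^ q + ‖∑ b ∈ t, u b‖ₑ ^ q) := by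
    intro t ht
    refine enorm_rpow_le_of_sub_eq ?_ hq
    rw [Finset.sum_insert fun h => has (Finset.mem_powerset.1 ht h), add_sub_cancel_right]
  calc ((insert a s).powerset.card : ℝ≥0∞) * ‖u a‖ₑ ^ q
      = 2 * ∑ _t ∈ s.powerset, ‖u a‖ₑ ^ q := by
        rw [Finset.card_powerset, Finset.card_insert_of_notMem has, Finset.sum_const,
          Finset.card_powerset, nsmul_eq_mul, pow_succ']
        push_cast
        ring
    _ ≤ 2 * ∑ t ∈ s.powerset, 2 ^ q * (‖∑ b ∈ insert a t, u b‖ₑ ^ q + ‖∑ b ∈ t, u b‖ₑ ^ q) := by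
        gcongr with t ht
        exact hpair t ht
    _ = 2 * 2 ^ q * ∑ t ∈ (insert a s).powerset, ‖∑ b ∈ t, u b‖ₑ ^ q := by
        rw [Finset.sum_powerset_insert has, ← Finset.mul_sum, Finset.sum_add_distrib,
          add_comm (∑ t ∈ s.powerset, ‖∑ b ∈ insert a t, u b‖ₑ ^ q), mul_assoc]

lemma card_piFinset_mul_prod_enorm_rpow_le {E : Type*} [SeminormedAddCommGroup E] [DecidableEq κ]
    (u : κ → ι → E) {s : Finset ι} {a : ι} (ha : a ∈ s) (hq : ∀ i, 0 ≤ q i) :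
    ((Fintype.piFinset fun _ : κ => s.powerset).card : ℝ≥0∞) * ∏ i, ‖u i a‖ₑ ^ q i ≤
      (∏ i, 2 * 2 ^ q i) *
        ∑ t ∈ Fintype.piFinset fun _ : κ => s.powerset, ∏ i, ‖∑ b ∈ t i, u i b‖ₑ ^ q i := by
  rw [← Finset.prod_univ_sum (fun _ => s.powerset) fun i t => ‖∑ b ∈ t, u i b‖ₑ ^ q i,
    Fintype.card_piFinset, Nat.cast_prod, ← Finset.prod_mul_distrib, ← Finset.prod_mul_distrib]
  exact Finset.prod_le_prod' fun i _ => card_powerset_mul_enorm_rpow_le (u i) ha (hq i)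

lemma exists_subsets_sum_setLIntegral_le {Λ : Set ℂ} {N : ℕ} (hΛ : IsWhitneyLattice Λ N)
    (μ : Measure ℂ) (hq : ∀ i, 0 ≤ q i) {u : κ → ℂ → ℂ → ℂ} (hu : ∀ i a, Measurable (u i a))
    {s : Finset ℂ} (hs : ↑s ⊆ Λ) :
    ∃ t : κ → Finset ℂ, (∀ i, t i ⊆ s) ∧
      ∑ a ∈ s, ∫⁻ z in whitneyBall a, ∏ i, ‖u i a z‖ₑ ^ q i ∂μ ≤
        N * (∏ i, 2 * 2 ^ q i) * ∫⁻ z in disc, ∏ i, ‖∑ b ∈ t i, u i b z‖ₑ ^ q i ∂μ := by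
  classical
  let T : Finset (κ → Finset ℂ) := Fintype.piFinset fun _ => s.powerset
  let F (t : κ → Finset ℂ) (z : ℂ) : ℝ≥0∞ := ∏ i, ‖∑ b ∈ t i, u i b z‖ₑ ^ q i
  let C : ℝ≥0∞ := ∏ i, 2 * 2 ^ q i
  have hF (t : κ → Finset ℂ) : Measurable (F t) :=
    Finset.measurable_prod _ fun i _ =>
      (Finset.measurable_sum _ fun b _ => hu i b).enorm.pow_const _
  have hT : T.Nonempty :=
    Fintype.piFinset_nonempty.2 fun _ => ⟨∅, Finset.empty_mem_powerset s⟩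
  have hT0 : (T.card : ℝ≥0∞) ≠ 0 := Nat.cast_ne_zero.2 hT.card_pos.ne'
  have hTtop : (T.card : ℝ≥0∞) ≠ ∞ := ENNReal.natCast_ne_top _
  obtain ⟨t, htT, hmax⟩ := T.exists_max_image (fun t => ∫⁻ z in disc, F t z ∂μ) hT
  refine ⟨t, fun i => Finset.mem_powerset.1 (Fintype.mem_piFinset.1 htT i), ?_⟩
  rw [← ENNReal.mul_le_mul_iff_right hT0 hTtop]
  calc (T.card : ℝ≥0∞) * ∑ a ∈ s, ∫⁻ z in whitneyBall a, ∏ i, ‖u i a z‖ₑ ^ q i ∂μ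
      = ∑ a ∈ s, ∫⁻ z in whitneyBall a, T.card * ∏ i, ‖u i a z‖ₑ ^ q i ∂μ := by
        rw [Finset.mul_sum]
        exact Finset.sum_congr rfl fun a _ => (lintegral_const_mul' _ _ hTtop).symm
    _ ≤ ∑ a ∈ s, ∫⁻ z in whitneyBall a, C * ∑ t ∈ T, F t z ∂μ := by
        refine Finset.sum_le_sum fun a ha => lintegral_mono fun z => ?_
        exact card_piFinset_mul_prod_enorm_rpow_le (fun i b => u i b z) ha hq
    _ ≤ N * ∫⁻ z in disc, C * ∑ t ∈ T, F t z ∂μ := hΛ.sum_setLIntegral_le μ _ hs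
    _ = N * C * ∑ t ∈ T, ∫⁻ z in disc, F t z ∂μ := by
        rw [lintegral_const_mul _ (Finset.measurable_sum _ fun t _ => hF t),
          lintegral_finsetSum _ fun t _ => hF t, mul_assoc]
    _ ≤ N * C * (T.card • ∫⁻ z in disc, F t z ∂μ) := by
        gcongr
        exact Finset.sum_le_card_nsmul _ _ _ hmax
    _ = T.card * (N * C * ∫⁻ z in disc, F t z ∂μ) := by
        rw [nsmul_eq_mul]
        ring

end RandomSubsets

section TestFunctions

variable {κ : Type*} [Fintype κ] [Nonempty κ] {α β p q : κ → ℝ} {w : κ → ℝ → ℝ} {μ : Measure ℂ}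

lemma exists_enorm_rpow_mul_eq {p : ℝ} (hp : 0 < p) {v y : ℝ≥0∞} (hv : v ≠ 0) (hv' : v ≠ ∞)
    (hy : y ≠ ∞) : ∃ c : ℂ, ‖c‖ₑ ^ p * v = y := by
  have htop : (y / v) ^ p⁻¹ ≠ ∞ :=
    ENNReal.rpow_ne_top_of_nonneg (inv_nonneg.2 hp.le) (ENNReal.div_ne_top hy hv)
  refine ⟨(((y / v) ^ p⁻¹).toReal : ℝ), ?_⟩
  rw [← ofReal_norm, Complex.norm_of_nonneg ENNReal.toReal_nonneg, ENNReal.ofReal_toReal htop,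
    ENNReal.rpow_inv_rpow hp.ne', ENNReal.div_mul_cancel hv hv']

lemma prod_enorm_rpow_mul_cellArea_rpow (hw : ∀ i, IsPowerWeight (α i) (β i) (w i))
    (hp : ∀ i, 0 < p i) (hq : ∀ i, 0 < q i) {a : ℂ} (ha : a ∈ disc) {c : κ → ℂ} {y : ℝ≥0∞}
    (hc : ∀ i, ‖c i‖ₑ ^ p i * cellArea (w i) a = y) :
    (∏ i, ‖c i‖ₑ ^ q i) * cellArea (meanWeight p q w) a ^ carlesonExponent p q =
      y ^ carlesonExponent p q := by
  have hθ (i : κ) : 0 ≤ q i / p i := (div_pos (hq i) (hp i)).le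
  rw [cellArea_meanWeight_rpow hw hp hq ha, carlesonExponent, rpow_sum_eq_prod_rpow _ hθ,
    ← Finset.prod_mul_distrib]
  refine Finset.prod_congr rfl fun i _ => ?_
  rw [← hc i, ENNReal.mul_rpow_of_nonneg _ _ (hθ i), ← ENNReal.rpow_mul,
    mul_div_cancel₀ _ (hp i).ne']

lemma cellMass_mul_rpow_le_setLIntegral (hw : ∀ i, IsPowerWeight (α i) (β i) (w i))
    (hp : ∀ i, 0 < p i) (hq : ∀ i, 0 < q i) {a : ℂ} (ha : a ∈ disc) {c : κ → ℂ} {y : ℝ≥0∞}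
    (hc : ∀ i, ‖c i‖ₑ ^ p i * cellArea (w i) a = y) (M : κ → ℕ) :
    (∏ i, ((3 : ℝ≥0∞)⁻¹ ^ M i) ^ q i) *
        (cellMass (carlesonExponent p q) (meanWeight p q w) μ a * y ^ carlesonExponent p q) ≤
      ∫⁻ z in whitneyBall a, ∏ i, ‖c i * szegoKernel a z ^ M i‖ₑ ^ q i ∂μ := by
  obtain ⟨α', β', hw'⟩ := exists_isPowerWeight_meanWeight hw hp hq
  have hlam := carlesonExponent_pos hp hq
  set V := cellArea (meanWeight p q w) a ^ carlesonExponent p q with hV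
  have hV0 : V ≠ 0 := by
    simp [hV, ENNReal.rpow_eq_zero_iff, hw'.cellArea_ne_zero ha, hlam.le.not_gt]
  have hVtop : V ≠ ∞ := ENNReal.rpow_ne_top_of_nonneg hlam.le cellArea_ne_top
  have hmass : cellMass (carlesonExponent p q) (meanWeight p q w) μ a * y ^ carlesonExponent p q =
      (∏ i, ‖c i‖ₑ ^ q i) * μ (whitneyCell a) := by
    rw [cellMass, ← prod_enorm_rpow_mul_cellArea_rpow hw hp hq ha hc, ← hV, mul_left_comm,
      ENNReal.div_mul_cancel hV0 hVtop]
  rw [hmass, ← mul_assoc, ← Finset.prod_mul_distrib, ← setLIntegral_const]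
  refine (setLIntegral_mono' Metric.isClosed_closedBall.measurableSet fun z hz => ?_).trans
    (lintegral_mono_set (whitneyCell_subset_whitneyBall ha))
  refine Finset.prod_le_prod' fun i _ => ?_
  rw [← ENNReal.mul_rpow_of_nonneg _ _ (hq i).le, enorm_mul, enorm_pow, mul_comm]
  gcongr
  exacts [(hq i).le, one_third_le_enorm_szegoKernel ha hz]

lemma exists_sum_cellMass_le_lintegral_szegoSum {Λ : Set ℂ} {N : ℕ} (hΛ : IsWhitneyLattice Λ N)
    (hw : ∀ i, IsPowerWeight (α i) (β i) (w i)) (hp : ∀ i, 0 < p i) (hq : ∀ i, 0 < q i)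
    (μ : Measure ℂ) (M : κ → ℕ) :
    ∃ K ≠ (∞ : ℝ≥0∞), ∀ s : Finset ℂ, ↑s ⊆ Λ → ∀ x : ℂ → ℝ≥0∞, ∑ a ∈ s, x a ≤ 1 →
      ∃ (t : κ → Finset ℂ) (c : κ → ℂ → ℂ), (∀ i, t i ⊆ s) ∧
        (∀ i, ∑ a ∈ t i, ‖c i a‖ₑ ^ p i * cellArea (w i) a ≤ 1) ∧
        ∑ a ∈ s, cellMass (carlesonExponent p q) (meanWeight p q w) μ a *
            x a ^ carlesonExponent p q ≤
          K * ∫⁻ z in disc, ∏ i, ‖szegoSum (M i) (t i) (c i) z‖ₑ ^ q i ∂μ := by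
  let k : ℝ≥0∞ := ∏ i, ((3 : ℝ≥0∞)⁻¹ ^ M i) ^ q i
  have hk0 : k ≠ 0 := Finset.prod_ne_zero_iff.2 fun i _ => by
    simp [ENNReal.rpow_eq_zero_iff, (hq i).le.not_gt]
  have hktop : k ≠ ∞ := ENNReal.prod_ne_top fun i _ =>
    ENNReal.rpow_ne_top_of_nonneg (hq i).le (ENNReal.pow_ne_top (by simp))
  refine ⟨k⁻¹ * (N * ∏ i, 2 * 2 ^ q i), ?_, fun s hs x hx => ?_⟩
  · refine ENNReal.mul_ne_top (ENNReal.inv_ne_top.2 hk0) (ENNReal.mul_ne_top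
      (ENNReal.natCast_ne_top _) (ENNReal.prod_ne_top fun i _ => ENNReal.mul_ne_top
        ENNReal.ofNat_ne_top (ENNReal.rpow_ne_top_of_nonneg (hq i).le ENNReal.ofNat_ne_top)))
  have hdisc {a : ℂ} (ha : a ∈ s) : a ∈ disc := hΛ.subset_disc (hs ha)
  have hxtop {a : ℂ} (ha : a ∈ s) : x a ≠ ∞ :=
    ne_top_of_le_ne_top ENNReal.one_ne_top
      ((Finset.single_le_sum_of_canonicallyOrdered ha).trans hx)
  choose! c hc using fun (i : κ) (a : ℂ) (ha : a ∈ s) =>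
    exists_enorm_rpow_mul_eq (hp i) ((hw i).cellArea_ne_zero (hdisc ha)) cellArea_ne_top
      (hxtop ha)
  obtain ⟨t, hts, hle⟩ := exists_subsets_sum_setLIntegral_le hΛ μ (fun i => (hq i).le)
    (fun i a => ((measurable_szegoKernel a).pow_const (M i)).const_mul (c i a)) hs
  refine ⟨t, c, hts, fun i => ?_, ?_⟩
  · calc ∑ a ∈ t i, ‖c i a‖ₑ ^ p i * cellArea (w i) a = ∑ a ∈ t i, x a :=
          Finset.sum_congr rfl fun a ha => hc i a (hts i ha)
      _ ≤ 1 := (Finset.sum_le_sum_of_subset (hts i)).trans hx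
  · rw [mul_assoc, ← ENNReal.div_eq_inv_mul, ENNReal.le_div_iff_mul_le (.inl hk0) (.inl hktop),
      mul_comm, Finset.mul_sum]
    exact (Finset.sum_le_sum fun a ha =>
      cellMass_mul_rpow_le_setLIntegral hw hp hq (hdisc ha) (fun i => hc i a ha) M).trans hle

end TestFunctions

section TestSequences

variable {α β p : ℝ} {w : ℝ → ℝ} {Λ : Set ℂ} {N : ℕ}

lemma mem_bergmanSpace_iff (hp : 0 < p) {f : ℂ → ℂ} :
    f ∈ bergmanSpace p w ↔
      DifferentiableOn ℂ f disc ∧ ∫⁻ z, ‖f z‖ₑ ^ p ∂weightedArea w < ∞ := by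
  rw [← bergmanNorm_rpow hp, ENNReal.rpow_lt_top_iff_of_pos hp]
  rfl

lemma boundedSeq_of_lintegral_le (hp : 0 < p) {f : ℕ → ℂ → ℂ}
    (hf : ∀ k, DifferentiableOn ℂ (f k) disc) {B : ℝ≥0∞} (hB : B ≠ ∞)
    (hle : ∀ k, ∫⁻ z, ‖f k z‖ₑ ^ p ∂weightedArea w ≤ B) : BoundedSeq p w f := by
  have hBp : B ^ p⁻¹ ≠ ∞ := ENNReal.rpow_ne_top_of_nonneg (inv_nonneg.2 hp.le) hB
  refine ⟨fun k => (mem_bergmanSpace_iff hp).2 ⟨hf k, (hle k).trans_lt hB.lt_top⟩,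
    (B ^ p⁻¹).toNNReal, fun k => ?_⟩
  rw [ENNReal.coe_toNNReal hBp, ENNReal.le_rpow_inv_iff hp, bergmanNorm_rpow hp]
  exact hle k

lemma IsPowerWeight.one_mem_bergmanSpace (hw : IsPowerWeight α β w) (hp : 0 < p) :
    (1 : ℂ → ℂ) ∈ bergmanSpace p w := by
  obtain ⟨γ, hγ⟩ := exists_gt (max 1 (β + 1))
  obtain ⟨C, hC, hle⟩ := hw.exists_lintegral_szegoKernel_rpow_le
    ((le_max_left _ _).trans_lt hγ) ((le_max_right _ _).trans_lt hγ)
  refine (mem_bergmanSpace_iff hp).2 ⟨differentiableOn_const 1, lt_of_le_of_lt ?_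
    (ENNReal.mul_ne_top hC (cellArea_ne_top (w := w) (a := 0))).lt_top⟩
  simpa [szegoKernel] using hle 0 (Metric.mem_ball_self one_pos)

lemma IsPowerWeight.eventually_boundedSeq_szegoSum (hw : IsPowerWeight α β w)
    (hΛ : IsWhitneyLattice Λ N) (hp : 0 < p) :
    ∀ᶠ M : ℕ in atTop, ∀ (s : ℕ → Finset ℂ) (c : ℕ → ℂ → ℂ), (∀ k, ↑(s k) ⊆ Λ) →
      (∀ k, ∑ a ∈ s k, ‖c k a‖ₑ ^ p * cellArea w a ≤ 1) →
      BoundedSeq p w fun k => szegoSum M (s k) (c k) := by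
  filter_upwards [hw.exists_lintegral_szegoSum_le hΛ hp] with M ⟨C, hC, hle⟩ s c hs hc
  refine boundedSeq_of_lintegral_le hp
    (fun k => differentiableOn_szegoSum ((hs k).trans hΛ.subset_disc) (c k)) hC fun k => ?_
  exact (hle (s k) (hs k) (c k)).trans (mul_le_of_le_one_right' (hc k))

lemma IsPowerWeight.eventually_tendstoZeroOnCompacts_szegoSum (hw : IsPowerWeight α β w)
    (hΛ : IsWhitneyLattice Λ N) (hp : 0 < p) :
    ∀ᶠ M : ℕ in atTop, ∀ (s : ℕ → Finset ℂ) (c : ℕ → ℂ → ℂ) (τ : ℕ → ℝ≥0∞),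
      (∀ k, ↑(s k) ⊆ Λ) → (∀ k, ∑ a ∈ s k, ‖c k a‖ₑ ^ p * cellArea w a ≤ 1) →
      (∀ k, ∀ a ∈ s k, depth a ≤ τ k) → Tendsto τ atTop (𝓝 0) →
      TendstoZeroOnCompacts fun k => szegoSum M (s k) (c k) := by
  filter_upwards [hw.exists_enorm_szegoSum_rpow_le hΛ hp] with M hM s c τ hs hc hsτ hτ K hKd hK
  obtain ⟨r, hr, hKr⟩ := exists_lt_subset_ball hK.isClosed hKd
  obtain ⟨C, hC, hle⟩ := hM r hr
  have hlim : Tendsto (fun k => C * τ k) atTop (𝓝 0) := by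
    simpa using ENNReal.Tendsto.const_mul hτ (.inr hC)
  rw [Metric.tendstoUniformlyOn_iff]
  intro δ hδ
  have hδp : 0 < ENNReal.ofReal δ ^ p := ENNReal.rpow_pos (ENNReal.ofReal_pos.2 hδ) (by simp)
  filter_upwards [hlim.eventually_lt_const hδp] with k hk z hz
  have hsmall : ‖szegoSum M (s k) (c k) z‖ₑ ^ p < ENNReal.ofReal δ ^ p :=
    calc ‖szegoSum M (s k) (c k) z‖ₑ ^ p
        ≤ C * (τ k * ∑ a ∈ s k, ‖c k a‖ₑ ^ p * cellArea w a) :=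
          hle _ (hs k) _ (hsτ k) _ z (Metric.ball_subset_closedBall (hKr hz))
      _ ≤ C * τ k := by gcongr; exact mul_le_of_le_one_right' (hc k)
      _ < ENNReal.ofReal δ ^ p := hk
  rwa [ENNReal.rpow_lt_rpow_iff hp, ← ofReal_norm, ENNReal.ofReal_lt_ofReal_iff hδ,
    ← dist_zero_left] at hsmall

end TestSequences

section Necessity

variable {κ : Type*} [Fintype κ] {α β p q : κ → ℝ} {w : κ → ℝ → ℝ} {Λ : Set ℂ} {N : ℕ}
  {μ : Measure ℂ}

lemma VanishesOnNullSequences.measure_disc_lt_top (h : VanishesOnNullSequences p q w μ)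
    (hw : ∀ i, IsPowerWeight (α i) (β i) (w i)) (hp : ∀ i, 0 < p i) : μ disc < ∞ := by
  have hhalf : ‖(2⁻¹ : ℂ)‖ < 1 := by norm_num
  have hlim := h (fun _ k => (2⁻¹ : ℂ) ^ k • 1)
    (fun i => boundedSeq_smul
      (fun k => (norm_pow_le _ k).trans (pow_le_one₀ (norm_nonneg _) hhalf.le))
      ((hw i).one_mem_bergmanSpace (hp i)))
    (fun _ => tendstoZeroOnCompacts_smul (tendsto_pow_atTop_nhds_zero_of_norm_lt_one hhalf)
      continuousOn_const)
  obtain ⟨k, hk⟩ := (hlim.eventually_lt_const zero_lt_one).exists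
  simp only [Pi.smul_apply, Pi.one_apply, setLIntegral_const] at hk
  refine ENNReal.lt_top_of_mul_ne_top_right hk.ne_top (Finset.prod_ne_zero_iff.2 fun i _ => ?_)
  simp [ENNReal.rpow_eq_zero_iff]

theorem VanishesOnNullSequences.hasVanishingCellMasses [Nonempty κ]
    (h : VanishesOnNullSequences p q w μ) (hΛ : IsWhitneyLattice Λ N)
    (hw : ∀ i, IsPowerWeight (α i) (β i) (w i)) (hp : ∀ i, 0 < p i) (hq : ∀ i, 0 < q i) :
    HasVanishingCellMasses Λ (carlesonExponent p q) (meanWeight p q w) μ := by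
  refine ⟨fun r hr => (measure_mono (Metric.closedBall_subset_ball hr)).trans_lt
    (h.measure_disc_lt_top hw hp), fun ε hε => ?_⟩
  by_contra! hlarge
  choose M hbdd hnull using fun i => (((hw i).eventually_boundedSeq_szegoSum hΛ (hp i)).and
    ((hw i).eventually_tendstoZeroOnCompacts_szegoSum hΛ (hp i))).exists
  obtain ⟨K, hK, htest⟩ := exists_sum_cellMass_le_lintegral_szegoSum hΛ hw hp hq μ M
  choose s hsΛ hdepth x hx hεx using fun k : ℕ => hlarge (1 / ((k : ℝ) + 1)) (by positivity)
  choose t c hts hc hle using fun k => htest (s k) (hsΛ k) (x k) (hx k)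
  have htΛ (i : κ) (k : ℕ) : ↑(t k i) ⊆ Λ := (Finset.coe_subset.2 (hts k i)).trans (hsΛ k)
  have hτ : Tendsto (fun k : ℕ => ENNReal.ofReal (1 / ((k : ℝ) + 1))) atTop (𝓝 0) := by
    simpa using ENNReal.tendsto_ofReal (tendsto_one_div_add_atTop_nhds_zero_nat (𝕜 := ℝ))
  have hlim : Tendsto (fun k => K * ∫⁻ z in disc,
      ∏ i, ‖szegoSum (M i) (t k i) (c k i) z‖ₑ ^ q i ∂μ) atTop (𝓝 0) := by
    simpa using ENNReal.Tendsto.const_mul (h (fun i k => szegoSum (M i) (t k i) (c k i))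
      (fun i => hbdd i _ _ (htΛ i) fun k => hc k i)
      fun i => hnull i _ _ _ (htΛ i) (fun k => hc k i)
        (fun k a ha => ENNReal.ofReal_le_ofReal (hdepth k a (hts k i ha)).le) hτ) (.inr hK)
  obtain ⟨k, hk⟩ := (hlim.eventually_lt_const (pos_iff_ne_zero.2 hε)).exists
  exact ((hεx k).trans_le (hle k)).not_gt hk

theorem hasVanishingCellMasses_iff_vanishesOnNullSequences [Nonempty κ]
    (hΛ : IsWhitneyLattice Λ N) (hw : ∀ i, IsPowerWeight (α i) (β i) (w i))
    (hp : ∀ i, 0 < p i) (hq : ∀ i, 0 < q i) :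
    HasVanishingCellMasses Λ (carlesonExponent p q) (meanWeight p q w) μ ↔
      VanishesOnNullSequences p q w μ :=
  ⟨fun h => h.vanishesOnNullSequences hΛ hw hp hq, fun h => h.hasVanishingCellMasses hΛ hw hp hq⟩

theorem isVanishingCarleson_meanWeight_iff [Nonempty κ]
    (hw : ∀ i, IsPowerWeight (α i) (β i) (w i)) (hp : ∀ i, 0 < p i) (hq : ∀ i, 0 < q i) :
    IsVanishingCarleson (carlesonExponent p q) 1 (meanWeight p q w) μ ↔
      VanishesOnNullSequences p q w μ := by
  obtain ⟨Λ, N, hΛ⟩ := exists_isWhitneyLattice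
  obtain ⟨α', β', hw'⟩ := exists_isPowerWeight_meanWeight hw hp hq
  have hlam := carlesonExponent_pos hp hq
  have hunit := hasVanishingCellMasses_iff_vanishesOnNullSequences (μ := μ) hΛ
    (fun _ : Unit => hw') (fun _ => one_pos) fun _ => hlam
  rw [carlesonExponent_unit, meanWeight_unit one_pos hlam, div_one] at hunit
  rw [isVanishingCarleson_iff_vanishesOnNullSequences hw' one_pos hlam, ← hunit,
    hasVanishingCellMasses_iff_vanishesOnNullSequences hΛ hw hp hq]

end Necessity

section UnitBallSup

variable {n : ℕ} {p q : Fin (n + 1) → ℝ} {w : Fin (n + 1) → ℝ → ℝ} {μ : Measure ℂ}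

/-- The quantity `F` of condition (ii): the largest integral of `|f| ^ q₀ ∏ |gᵢ| ^ qᵢ` for `gᵢ` in
the unit balls of the remaining spaces. -/
def unitBallSup (p q : Fin (n + 1) → ℝ) (w : Fin (n + 1) → ℝ → ℝ) (μ : Measure ℂ) (f : ℂ → ℂ) :
    ℝ≥0∞ :=
  ⨆ (g : Fin n → ℂ → ℂ) (_ : ∀ i, g i ∈ bergmanSpace (p i.succ) (w i.succ) ∧
      bergmanNorm (p i.succ) (w i.succ) (g i) ≤ 1),
    ∫⁻ z in disc, ‖f z‖ₑ ^ q 0 * ∏ i, ‖g i z‖ₑ ^ q i.succ ∂μ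

theorem HasVanishingCellMasses.tendsto_unitBallSup {α β : Fin (n + 1) → ℝ} {Λ : Set ℂ} {N : ℕ}
    (h : HasVanishingCellMasses Λ (carlesonExponent p q) (meanWeight p q w) μ)
    (hΛ : IsWhitneyLattice Λ N) (hw : ∀ i, IsPowerWeight (α i) (β i) (w i))
    (hp : ∀ i, 0 < p i) (hq : ∀ i, 0 < q i) {f : ℕ → ℂ → ℂ} (hf : BoundedSeq (p 0) (w 0) f)
    (hf0 : TendstoZeroOnCompacts f) :
    Tendsto (fun k => unitBallSup p q w μ (f k)) atTop (𝓝 0) := by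
  obtain ⟨B, hB, hfB⟩ := hf.exists_lintegral_le (hp 0)
  refine ENNReal.tendsto_nhds_zero.2 fun ε hε => ?_
  obtain ⟨r, hr, δ, hδ, hsmall⟩ := h.exists_setLIntegral_prod_le hΛ hw hp hq
    (max_ne_top hB ENNReal.one_ne_top) hε.ne' 0
  have hball : Metric.closedBall 0 r ⊆ disc := Metric.closedBall_subset_ball hr
  filter_upwards [Metric.tendstoUniformlyOn_iff.1 (hf0 _ hball (isCompact_closedBall 0 r)) δ hδ]
    with k hk
  refine iSup₂_le fun g hg => ?_
  have hgB (i : Fin n) : ∫⁻ z, ‖g i z‖ₑ ^ p i.succ ∂weightedArea (w i.succ) ≤ 1 := by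
    rw [← bergmanNorm_rpow (hp _)]
    exact ENNReal.rpow_le_one (hg i).2 (hp _).le
  simpa only [Fin.prod_univ_succ, Fin.cons_zero, Fin.cons_succ] using
    hsmall (Fin.cons (f k) g) (Fin.cases (hf.1 k).1 fun i => (hg i).1.1)
      (Fin.cases ((hfB k).trans (le_max_left B 1)) fun i => (hgB i).trans (le_max_right B 1))
      fun z hz => by simpa using hk z hz

lemma lintegral_prod_le_mul_unitBallSup (hq : ∀ i, 0 < q i) {f : Fin (n + 1) → ℂ → ℂ}
    (hf : ∀ i, f i ∈ bergmanSpace (p i) (w i)) {d : Fin (n + 1) → ℂ} (hd : ∀ i, d i ≠ 0)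
    (hfd : ∀ i, bergmanNorm (p i) (w i) (f i) ≤ ‖d i‖ₑ) :
    ∫⁻ z in disc, ∏ i, ‖f i z‖ₑ ^ q i ∂μ ≤
      (∏ i : Fin n, ‖d i.succ‖ₑ ^ q i.succ) * unitBallSup p q w μ (f 0) := by
  let g (i : Fin n) : ℂ → ℂ := (d i.succ)⁻¹ • f i.succ
  have hg (i : Fin n) : g i ∈ bergmanSpace (p i.succ) (w i.succ) ∧
      bergmanNorm (p i.succ) (w i.succ) (g i) ≤ 1 := by
    refine ⟨const_smul_mem_bergmanSpace _ (hf _), ?_⟩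
    rw [bergmanNorm_const_smul, enorm_inv (hd _), mul_comm]
    exact ENNReal.div_le_of_le_mul (by simpa using hfd i.succ)
  have hfg (z : ℂ) : ∏ i, ‖f i z‖ₑ ^ q i = (∏ i : Fin n, ‖d i.succ‖ₑ ^ q i.succ) *
      (‖f 0 z‖ₑ ^ q 0 * ∏ i, ‖g i z‖ₑ ^ q i.succ) := by
    rw [Fin.prod_univ_succ, mul_left_comm, ← Finset.prod_mul_distrib]
    congr 1
    refine Finset.prod_congr rfl fun i _ => ?_
    rw [← ENNReal.mul_rpow_of_nonneg _ _ (hq _).le, ← enorm_mul,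
      show g i z = (d i.succ)⁻¹ * f i.succ z from rfl, mul_inv_cancel_left₀ (hd _)]
  have hdtop : ∏ i : Fin n, ‖d i.succ‖ₑ ^ q i.succ ≠ ∞ := ENNReal.prod_ne_top fun i _ =>
    ENNReal.rpow_ne_top_of_nonneg (hq _).le enorm_ne_top
  simp only [hfg]
  rw [lintegral_const_mul' _ _ hdtop]
  gcongr
  exact le_iSup₂_of_le g hg le_rfl

lemma BoundedSeq.exists_bergmanNorm_le_enorm {p : ℝ} {w : ℝ → ℝ} {f : ℕ → ℂ → ℂ}
    (hf : BoundedSeq p w f) : ∃ d : ℂ, d ≠ 0 ∧ ∀ k, bergmanNorm p w (f k) ≤ ‖d‖ₑ := by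
  obtain ⟨C, hC⟩ := hf.2
  have hd : ‖((C + 1 : ℝ) : ℂ)‖ₑ = (C + 1 : ℝ≥0) := by
    rw [← ofReal_norm, Complex.norm_of_nonneg (by positivity), ← NNReal.coe_one, ← NNReal.coe_add,
      ENNReal.ofReal_coe_nnreal]
  refine ⟨((C + 1 : ℝ) : ℂ), Complex.ofReal_ne_zero.2 (by positivity), fun k => ?_⟩
  rw [hd]
  exact (hC k).trans (ENNReal.coe_le_coe.2 le_self_add)

theorem vanishesOnNullSequences_of_tendsto_unitBallSup (hq : ∀ i, 0 < q i)
    (h : ∀ f, BoundedSeq (p 0) (w 0) f → TendstoZeroOnCompacts f →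
      Tendsto (fun k => unitBallSup p q w μ (f k)) atTop (𝓝 0)) :
    VanishesOnNullSequences p q w μ := by
  intro f hf hf0
  choose d hd hfd using fun i => (hf i).exists_bergmanNorm_le_enorm
  have hdtop : ∏ i : Fin n, ‖d i.succ‖ₑ ^ q i.succ ≠ ∞ := ENNReal.prod_ne_top fun i _ =>
    ENNReal.rpow_ne_top_of_nonneg (hq _).le enorm_ne_top
  have hlim := ENNReal.Tendsto.const_mul (h _ (hf 0) (hf0 0)) (.inr hdtop)
  rw [mul_zero] at hlim
  exact tendsto_of_tendsto_of_tendsto_of_le_of_le tendsto_const_nhds hlim (fun _ => zero_le)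
    fun k => lintegral_prod_le_mul_unitBallSup hq (fun i => (hf i).1 k) hd fun i => hfd i k

end UnitBallSup

end WeightedBergman

end

/-- There are `n + 1 ≥ 1` factors, indexed by `Fin (n + 1)`; the distinguished one has index `0`.
A positive Borel measure on the disc is given as the restriction to the disc of a Borel measure `μ`
on the plane. -/
theorem theorem3 (n : ℕ) (p q : Fin (n + 1) → ℝ) (hp : ∀ i, 0 < p i) (hq : ∀ i, 0 < q i)
    (w : Fin (n + 1) → ℝ → ℝ) (hw : ∀ i, WeightedBergman.IsRegularWeight (w i))
    (μ : Measure ℂ)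
    (lam : ℝ) (hlam : lam = ∑ i, q i / p i)
    (om : ℝ → ℝ) (hom : om = fun r => ∏ i, w i r ^ (q i / (lam * p i))) :
    List.TFAE [
      WeightedBergman.IsVanishingCarleson lam 1 om μ,
      ∀ f : ℕ → ℂ → ℂ, WeightedBergman.BoundedSeq (p 0) (w 0) f →
        WeightedBergman.TendstoZeroOnCompacts f →
        Tendsto (fun k : ℕ =>
          ⨆ (g : Fin n → ℂ → ℂ)
            (_ : ∀ i, g i ∈ WeightedBergman.bergmanSpace (p i.succ) (w i.succ) ∧
              WeightedBergman.bergmanNorm (p i.succ) (w i.succ) (g i) ≤ 1),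
            ∫⁻ z in WeightedBergman.disc,
              ‖f k z‖ₑ ^ q 0 * ∏ i, ‖g i z‖ₑ ^ q i.succ ∂μ)
          atTop (𝓝 0),
      ∀ f : Fin (n + 1) → ℕ → ℂ → ℂ,
        (∀ i, WeightedBergman.BoundedSeq (p i) (w i) (f i)) →
        (∀ i, WeightedBergman.TendstoZeroOnCompacts (f i)) →
        Tendsto (fun k : ℕ =>
          ∫⁻ z in WeightedBergman.disc, ∏ i, ‖f i k z‖ₑ ^ q i ∂μ)
          atTop (𝓝 0)] := by
  subst hlam hom
  choose α β hpw using fun i => (hw i).exists_isPowerWeight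
  obtain ⟨Λ, N, hΛ⟩ := WeightedBergman.exists_isWhitneyLattice
  tfae_have 1 ↔ 3 := WeightedBergman.isVanishingCarleson_meanWeight_iff hpw hp hq
  tfae_have 3 → 2 := fun h f hf hf0 =>
    (WeightedBergman.VanishesOnNullSequences.hasVanishingCellMasses h hΛ hpw hp
      hq).tendsto_unitBallSup hΛ hpw hp hq hf hf0
  tfae_have 2 → 3 := WeightedBergman.vanishesOnNullSequences_of_tendsto_unitBallSup hq
  tfae_finish
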